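/- Let $\Bbbk$ be an algebraically closed field of arbitrary characteristic, let $M$ be a free abelian group of finite rank $n$, and let $A=\{u_0,\dots,u_N\}\subset M$ be a finite set which spans the affine lattice $M$, i.e. every element of $M$ is of the form $\sum_i a_iu_i$ with $a_i\in\mathbb Z$ and $\sum_i a_i=1$. Let $T_M=\operatorname{Spec}\Bbbk[M]$, and let $X_A\subset\mathbb P^N$ be the closure of the image of $\varphi_A:T_M\to\mathbb P^N$, $t\mapsto[z^{u_0}(t):\cdots:z^{u_N}(t)]$; for finite nonempty subsets of other free abelian groups of finite rank the same notation is used. Let $\gamma$ be the Gauss map of $X_A$, i.e. the rational map $X_A\dashrightarrow\mathbb G(n,\mathbb P^N)$ sending a smooth point $x$ to the embedded tangent space $\mathbb T_xX_A$. The rank $\operatorname{rk}(\gamma)$ is the rank of the tangent map $d_x\gamma$ at a general point $x\in X_A$, and $\gamma$ is called separable if the field extension $K(X_A)/K(\gamma(X_A))$ is separable. Put $$B=\{u_{i_0}+\cdots+u_{i_n} : u_{i_0},\dots,u_{i_n}\in A \text{ span the affine space } M\otimes_{\mathbb Z}\Bbbk\},$$ let $\langle B-B\rangle\subset M$ be the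 subgroup generated by the differences of elements of $B$, and let $\pi:M\to M'=M/(\langle B-B\rangle_{\mathbb R}\cap M)$ be the projection. Then $$\operatorname{rk}(\gamma)\le n-(\#\pi(A)-1).$$ If moreover $\gamma$ is separable, then $\#\pi(A)=\operatorname{rank}M'+1$, and $X_{\pi(A)}$ is the whole projective space $\mathbb P^{\#\pi(A)-1}$, of dimension $\operatorname{rank}M'$. Consequently, in this case the closure in $\mathbb P^N$ of every fiber $\{y\in\varphi_A(T_M) : \gamma(y)=\gamma(\varphi_A(t))\}$, $t\in T_M$, of the restriction of $\gamma$ to the open dense torus $\varphi_A(T_M)\subset X_A$ is the image of $X_{\pi(A)}$ under a linear embedding $\mathbb P^{\#\pi(A)-1}\hookrightarrow\mathbb P^N$, hence a linear subspace of dimension $\operatorname{rank}M'$. -/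

import Mathlib

open scoped LinearAlgebra.Projectivization TensorProduct

noncomputable section

namespace ToricGauss

/-! ### Projective varieties over a field, as sets of closed points -/

section Projective

variable {k : Type*} [Field k] {ι κ : Type*}

/-- `f` vanishes at `x`: it vanishes at every nonzero vector representing `x`. For homogeneous `f`
one representative suffices. -/
def VanishesAt (f : MvPolynomial ι k) (x : ℙ k (ι → k)) : Prop :=
  ∀ (v : ι → k) (hv : v ≠ 0), Projectivization.mk k v hv = x → MvPolynomial.eval v f = 0

/-- The ideal of the polynomials vanishing on the affine cone over `S`. Over an infinite field this
is the homogeneous ideal generated by the forms vanishing on `S`. -/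
def vanishingIdeal (S : Set (ℙ k (ι → k))) : Ideal (MvPolynomial ι k) where
  carrier := {f | ∀ x ∈ S, VanishesAt f x}
  add_mem' := by
    intro f g hf hg x hx v hv h
    rw [map_add, hf x hx v hv h, hg x hx v hv h, add_zero]
  zero_mem' := by
    intro x _ v _ _
    exact map_zero _
  smul_mem' := by
    intro c f hf x hx v hv h
    rw [smul_eq_mul, map_mul, hf x hx v hv h, mul_zero]

/-- The Zariski closure `V(I(S))` of a subset `S` of projective space. -/
def zariskiClosure (S : Set (ℙ k (ι → k))) : Set (ℙ k (ι → k)) :=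
  {x | ∀ f ∈ vanishingIdeal S, VanishesAt f x}

theorem subset_zariskiClosure (S : Set (ℙ k (ι → k))) : S ⊆ zariskiClosure S :=
  fun x hx _ hf => hf x hx

theorem vanishingIdeal_zariskiClosure (S : Set (ℙ k (ι → k))) :
    vanishingIdeal (zariskiClosure S) = vanishingIdeal S :=
  le_antisymm (fun _ hf x hx => hf x (subset_zariskiClosure S hx)) (fun f hf _ hx => hx f hf)

variable (k ι) in
/-- A (closed, irreducible) projective variety in the projective space with homogeneous coordinates
indexed by `ι`. -/
structure ProjVariety where
  /-- the set of closed points -/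
  carrier : Set (ℙ k (ι → k))
  isClosed : zariskiClosure carrier = carrier
  isPrime : (vanishingIdeal carrier).IsPrime

namespace ProjVariety

variable (X : ProjVariety k ι)

/-- The homogeneous ideal `I(X)`. -/
abbrev ideal : Ideal (MvPolynomial ι k) := vanishingIdeal X.carrier

instance : X.ideal.IsPrime := X.isPrime

/-- `P` holds for a general point of `X`, i.e. on the nonempty open subset of `X` where some form
`g ∉ I(X)` does not vanish (such subsets form a basis of the nonempty open subsets). -/
def Generically (P : ℙ k (ι → k) → Prop) : Prop :=
  ∃ (d : ℕ) (g : MvPolynomial ι k), g.IsHomogeneous d ∧ g ∉ X.ideal ∧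
    ∀ x ∈ X.carrier, MvPolynomial.eval x.rep g ≠ 0 → P x

/-- The fraction field of the homogeneous coordinate ring `k[x] / I(X)`. -/
abbrev ConeField : Type _ := FractionRing (MvPolynomial ι k ⧸ X.ideal)

/-- The quotient `f / g` in the fraction field of the homogeneous coordinate ring. -/
def frac (f g : MvPolynomial ι k) : X.ConeField :=
  algebraMap (MvPolynomial ι k ⧸ X.ideal) X.ConeField (Ideal.Quotient.mk X.ideal f) /
    algebraMap (MvPolynomial ι k ⧸ X.ideal) X.ConeField (Ideal.Quotient.mk X.ideal g)

/-- The function field `K(X)`: quotients `f / g` of forms of the same degree with `g ∉ I(X)`. -/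
def functionField : IntermediateField k X.ConeField :=
  IntermediateField.adjoin k {h | ∃ (d : ℕ) (f g : MvPolynomial ι k),
    f.IsHomogeneous d ∧ g.IsHomogeneous d ∧ g ∉ X.ideal ∧ h = X.frac f g}

/-- The dimension of `X`, as the transcendence degree of `K(X)` over `k`. -/
def dim : ℕ := Cardinal.toNat (Algebra.trdeg k X.functionField)

/-- The embedded tangent space `𝕋ₓX`, as a linear subspace of `k^ι`: the common kernel of
the differentials at `x` of all elements of `I(X)`. -/
def tangentSpace [Fintype ι] (x : ℙ k (ι → k)) : Submodule k (ι → k) where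
  carrier := {v | ∀ f ∈ X.ideal, ∑ i, MvPolynomial.eval x.rep (MvPolynomial.pderiv i f) * v i = 0}
  add_mem' := by
    intro v w hv hw f hf
    simp only [Pi.add_apply, mul_add, Finset.sum_add_distrib, hv f hf, hw f hf, add_zero]
  zero_mem' := by
    intro f _
    simp
  smul_mem' := by
    intro c v hv f hf
    have h := congrArg (fun a => c * a) (hv f hf)
    simpa [Finset.mul_sum, mul_left_comm] using h

/-- `x` is a smooth point of `X`: it lies on `X` and the projective dimension of `𝕋ₓX` is
`dim X`. -/
def IsSmoothAt [Fintype ι] (x : ℙ k (ι → k)) : Prop :=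
  x ∈ X.carrier ∧ Module.finrank k (X.tangentSpace x) = X.dim + 1

end ProjVariety

/-- A representative of a rational map from `X` to the projective space with coordinates indexed by
`κ`: forms of the same degree, not all of them in `I(X)`. -/
structure RationalMap (X : ProjVariety k ι) (κ : Type*) where
  /-- the forms -/
  poly : κ → MvPolynomial ι k
  /-- their common degree -/
  degree : ℕ
  isHomogeneous : ∀ j, (poly j).IsHomogeneous degree
  exists_notMem : ∃ j, poly j ∉ X.ideal

/-- The extension `E / F` is separable, for finitely generated `E / F` (not
necessarily algebraic): `E` is separable algebraic over a purely transcendental extension of `F`. -/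
def IsSeparableExtension (F E : Type*) [Field F] [Field E] [Algebra F E] : Prop :=
  ∃ s : Set E, IsTranscendenceBasis F ((↑) : s → E) ∧
    Algebra.IsSeparable (IntermediateField.adjoin F s) E

namespace RationalMap

variable {X : ProjVariety k ι} (φ : RationalMap X κ)

/-- The vector of the values at (the chosen representative of) `x`. -/
def evalAt (x : ℙ k (ι → k)) : κ → k := fun j => MvPolynomial.eval x.rep (φ.poly j)

/-- The differential at (the chosen representative of) `x` of the map `k^ι → k^κ` between
affine cones given by the forms of `φ`. -/
def coneDifferential [Fintype ι] (x : ℙ k (ι → k)) : (ι → k) →ₗ[k] (κ → k) :=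
  LinearMap.pi fun j => ∑ i, MvPolynomial.eval x.rep (MvPolynomial.pderiv i (φ.poly j)) •
    (LinearMap.proj i : (ι → k) →ₗ[k] k)

/-- The rank of the tangent map `dₓφ : tₓX → t_{φ(x)}ℙ` at a point where `φ` is given by its
forms. Here `tₓX` is `𝕋ₓX` modulo the line `x`, and the tangent space of the target is `k^κ` modulo
the line `φ(x)`; the line `x` is mapped into the line `φ(x)` by Euler's formula. -/
def rankAt [Fintype ι] (x : ℙ k (ι → k)) : ℕ :=
  Module.finrank k ((X.tangentSpace x).map
    ((Submodule.span k {φ.evalAt x}).mkQ ∘ₗ φ.coneDifferential x))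

/-- The rank of `φ` is `r`, i.e. `dₓφ` has rank `r` for a general (smooth) point `x` of `X`.
As any two nonempty open subsets of `X` meet, there is at most one such `r`. -/
def HasRank [Fintype ι] (r : ℕ) : Prop :=
  X.Generically fun x => X.IsSmoothAt x ∧ φ.evalAt x ≠ 0 ∧ φ.rankAt x = r

/-- The subfield `φ^* K(φ(X))` of `K(X)`, where `φ(X)` stands for the closure of the image: the
pullbacks of the quotients `f / g` of forms of the same degree on the target such that `g` does not
vanish identically on the image. -/
def imageField : IntermediateField k X.ConeField :=
  IntermediateField.adjoin k {h | ∃ (e : ℕ) (f g : MvPolynomial κ k),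
    f.IsHomogeneous e ∧ g.IsHomogeneous e ∧ MvPolynomial.aeval φ.poly g ∉ X.ideal ∧
      h = X.frac (MvPolynomial.aeval φ.poly f) (MvPolynomial.aeval φ.poly g)}

theorem imageField_le : φ.imageField ≤ X.functionField := by
  refine IntermediateField.adjoin.mono k _ _ ?_
  rintro h ⟨e, f, g, hf, hg, hgX, rfl⟩
  exact ⟨φ.degree * e, _, _, hf.aeval _ φ.isHomogeneous, hg.aeval _ φ.isHomogeneous, hgX, rfl⟩

/-- `φ` is separable: the field extension `K(X) / K(φ(X))` is separable. -/
def IsSeparable : Prop :=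
  IsSeparableExtension φ.imageField (IntermediateField.extendScalars φ.imageField_le)

end RationalMap

/-- `p` is a vector of homogeneous Plücker coordinates of the linear subspace `W` of dimension `m`:
the `m × m` minors of a matrix whose rows form a basis of `W`. The coordinates are indexed by all
`m`-tuples of indices rather than by the increasing ones only; this composes the usual Plücker
embedding with a linear embedding. -/
def IsPluckerVector {m : ℕ} (W : Submodule k (ι → k)) (p : (Fin m → ι) → k) : Prop :=
  ∃ w : Fin m → ι → k, LinearIndependent k w ∧ Submodule.span k (Set.range w) = W ∧
    p = fun I => (Matrix.of fun a b => w a (I b)).det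

/-- The rational map `γ` is the Gauss map of `X`, composed with the Plücker embedding: it sends a
general (smooth) point `x` to the embedded tangent space `𝕋ₓX`. -/
def ProjVariety.IsGaussMap [Fintype ι] (X : ProjVariety k ι)
    (γ : RationalMap X (Fin (X.dim + 1) → ι)) : Prop :=
  X.Generically fun x => X.IsSmoothAt x ∧ IsPluckerVector (X.tangentSpace x) (γ.evalAt x)

end Projective

/-! ### Toric varieties -/

section Toric

variable {k : Type*} [Field k] {M : Type*} [AddCommGroup M]

variable (k M) in
/-- The closed points of the torus `T_M = Spec k[M]`. -/
abbrev Torus : Type _ := Multiplicative M →* kˣ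

/-- The vector `(z^u(t))` for `u ∈ A`. -/
def torusVec (A : Finset M) (t : Torus k M) : A → k := fun u => (t (Multiplicative.ofAdd u.1) : k)

theorem torusVec_ne_zero {A : Finset M} (hA : A.Nonempty) (t : Torus k M) : torusVec A t ≠ 0 := by
  obtain ⟨u, hu⟩ := hA
  exact fun h => (t (Multiplicative.ofAdd u)).ne_zero (congrFun h ⟨u, hu⟩)

/-- The morphism `φ_A : T_M → ℙ^N`, `t ↦ [z^{u_0}(t) : ⋯ : z^{u_N}(t)]`, where `A = {u_0, …, u_N}`;
the homogeneous coordinates are indexed by the elements of `A`. -/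
def torusPoint (A : Finset M) (hA : A.Nonempty) (t : Torus k M) : ℙ k (A → k) :=
  Projectivization.mk k (torusVec A t) (torusVec_ne_zero hA t)

theorem mem_vanishingIdeal_range (A : Finset M) (hA : A.Nonempty) (f : MvPolynomial A k) :
    f ∈ vanishingIdeal (Set.range (torusPoint (k := k) A hA)) ↔
      ∀ (t : Torus k M) (c : kˣ), MvPolynomial.eval (fun u => (c : k) * torusVec A t u) f = 0 := by
  constructor
  · intro h t c
    have hne : (fun u => (c : k) * torusVec A t u) ≠ 0 := by
      intro h0
      refine torusVec_ne_zero hA t (funext fun u => ?_)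
      exact (mul_eq_zero.1 (congrFun h0 u)).resolve_left c.ne_zero
    refine h _ ⟨t, rfl⟩ _ hne ?_
    rw [torusPoint, Projectivization.mk_eq_mk_iff]
    exact ⟨c, rfl⟩
  · rintro h x ⟨t, rfl⟩ v hv hvx
    rw [torusPoint, Projectivization.mk_eq_mk_iff] at hvx
    obtain ⟨c, rfl⟩ := hvx
    exact h t c

theorem exists_unit_zpow_ne_one [Infinite k] {j : ℤ} (hj : j ≠ 0) : ∃ c : kˣ, c ^ j ≠ 1 := by
  by_contra! h
  have hp : (Polynomial.X * (Polynomial.X ^ j.natAbs - 1) : Polynomial k) = 0 := by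
    refine Polynomial.funext fun c => ?_
    by_cases hc : c = 0
    · simp [hc]
    · have h1 : (Units.mk0 c hc) ^ j.natAbs = 1 := by
        rcases Int.natAbs_eq j with h2 | h2
        · have := h (Units.mk0 c hc)
          rw [h2, zpow_natCast] at this
          exact this
        · have := h (Units.mk0 c hc)
          rw [h2, zpow_neg, zpow_natCast, inv_eq_one] at this
          exact this
      have h3 : c ^ j.natAbs = 1 := by simpa using congrArg Units.val h1
      simp [h3]
  rcases mul_eq_zero.1 hp with h1 | h1
  · exact Polynomial.X_ne_zero h1
  · exact Polynomial.X_pow_sub_C_ne_zero (Int.natAbs_pos.2 hj) (1 : k) (by simpa using h1)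

theorem exists_torus_ne [Infinite k] [Module.Free ℤ M] {m m' : M} (h : m ≠ m') :
    ∃ t : Torus k M, t (Multiplicative.ofAdd m) ≠ t (Multiplicative.ofAdd m') := by
  let b := Module.Free.chooseBasis ℤ M
  obtain ⟨i, hi⟩ : ∃ i, b.repr m i ≠ b.repr m' i := by
    by_contra! h'
    exact h (b.repr.injective (Finsupp.ext h'))
  obtain ⟨c, hc⟩ := exists_unit_zpow_ne_one (k := k) (sub_ne_zero.2 hi)
  refine ⟨(zpowersHom kˣ c).comp (AddMonoidHom.toMultiplicative (b.coord i).toAddMonoidHom), ?_⟩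
  intro h'
  apply hc
  have h2 : c ^ (b.repr m i) = c ^ (b.repr m' i) := h'
  rw [zpow_sub, h2, mul_inv_cancel]

theorem eq_zero_of_forall_torus [Infinite k] [Module.Free ℤ M] (g : AddMonoidAlgebra k M)
    (h : ∀ t : Torus k M, AddMonoidAlgebra.lift k k M ((Units.coeHom k).comp t) g = 0) : g = 0 := by
  let ev : M → (Torus k M →* k) := fun m =>
    (Units.coeHom k).comp (MonoidHom.eval (Multiplicative.ofAdd m))
  have hev : Function.Injective ev := by
    intro m m' hm
    by_contra hne
    obtain ⟨t, ht⟩ := exists_torus_ne (k := k) hne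
    exact ht (Units.ext (DFunLike.congr_fun hm t))
  have hli := (linearIndependent_monoidHom (Torus k M) k).comp ev hev
  rw [linearIndependent_iff] at hli
  have h0 := hli g.coeff (funext fun t => by
    have := h t
    rw [AddMonoidAlgebra.lift_apply] at this
    simpa [Finsupp.linearCombination_apply, Finsupp.sum, Finset.sum_apply, ev] using this)
  exact AddMonoidAlgebra.coeff_injective h0

/-- The toric variety `X_A`: the closure of the image of `φ_A`. -/
def toricVariety [Infinite k] [Module.Free ℤ M] [Module.Finite ℤ M] (A : Finset M)
    (hA : A.Nonempty) : ProjVariety k A where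
  carrier := zariskiClosure (Set.range (torusPoint A hA))
  isClosed := by
    rw [zariskiClosure, vanishingIdeal_zariskiClosure]
    rfl
  isPrime := by
    rw [vanishingIdeal_zariskiClosure]
    let Φ : MvPolynomial A k →ₐ[k] AddMonoidAlgebra k (M × ℤ) :=
      MvPolynomial.aeval fun u => AddMonoidAlgebra.single (u.1, 1) 1
    have : AddGroup.FG (M × ℤ) := Module.Finite.iff_addGroup_fg.1 inferInstance
    have : AddMonoid.FG (M × ℤ) := inferInstance
    have : IsAddTorsionFree (M × ℤ) := .of_isTorsionFree ℤ _
    have : IsDomain (AddMonoidAlgebra k (M × ℤ)) := NoZeroDivisors.to_isDomain _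
    convert (RingHom.ker_isPrime Φ.toRingHom : (RingHom.ker Φ.toRingHom).IsPrime) using 1
    ext f
    rw [mem_vanishingIdeal_range, RingHom.mem_ker]
    have key : ∀ χ : Torus k (M × ℤ),
        AddMonoidAlgebra.lift k k (M × ℤ) ((Units.coeHom k).comp χ) (Φ f) =
          MvPolynomial.eval (fun u : A => (χ (Multiplicative.ofAdd (u.1, 1)) : k)) f := by
      intro χ
      have : ((AddMonoidAlgebra.lift k k (M × ℤ) ((Units.coeHom k).comp χ)).comp Φ) =
          MvPolynomial.aeval (fun u : A => (χ (Multiplicative.ofAdd (u.1, 1)) : k)) := by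
        ext u
        simp [Φ]
      have h2 := DFunLike.congr_fun this f
      simpa [MvPolynomial.aeval_eq_eval] using h2
    constructor
    · intro h
      refine eq_zero_of_forall_torus (Φ f) fun χ => ?_
      rw [key]
      rw [← h (χ.comp (AddMonoidHom.toMultiplicative (AddMonoidHom.inl M ℤ)))
        (χ (Multiplicative.ofAdd (0, 1)))]
      congr 2
      funext u
      simp only [torusVec, MonoidHom.comp_apply, AddMonoidHom.toMultiplicative_apply_apply,
        AddMonoidHom.inl_apply, toAdd_ofAdd]
      rw [← Units.val_mul, ← map_mul, ← ofAdd_add]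
      simp
    · intro h t c
      let χ : Torus k (M × ℤ) :=
        (t.comp (AddMonoidHom.toMultiplicative (AddMonoidHom.fst M ℤ))) *
          ((zpowersHom kˣ c).comp (AddMonoidHom.toMultiplicative (AddMonoidHom.snd M ℤ)))
      have h1 := key χ
      rw [show Φ f = 0 from h, map_zero] at h1
      rw [h1]
      congr 2
      funext u
      simp [χ, torusVec, mul_comm]

/-- The set `B` of the sums `u_{i_0} + ⋯ + u_{i_n}` of `n + 1` elements of `A` which span the affine
space `M_k = k ⊗ M`, where `n` is the rank of `M`. -/
def basisSums (k : Type*) [Field k] (A : Finset M) : Set M :=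
  {m | ∃ u : Fin (Module.finrank ℤ M + 1) → M, (∀ i, u i ∈ A) ∧
    affineSpan k (Set.range fun i => (1 : k) ⊗ₜ[ℤ] u i) = ⊤ ∧ m = ∑ i, u i}

/-- The subgroup `L_ℝ ∩ M` of `M`, where `L_ℝ` is the real subspace of `M_ℝ = ℝ ⊗ M` spanned
by `L`. -/
def realSaturation (L : Submodule ℤ M) : Submodule ℤ M :=
  ((Submodule.span ℝ (TensorProduct.mk ℤ ℝ M 1 '' L)).restrictScalars ℤ).comap
    (TensorProduct.mk ℤ ℝ M 1)

/-- The subgroup `⟨B - B⟩_ℝ ∩ M` of `M`. -/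
def gaussKernel (k : Type*) [Field k] (A : Finset M) : Submodule ℤ M :=
  realSaturation (Submodule.span ℤ
    {m | ∃ b ∈ basisSums k A, ∃ b' ∈ basisSums k A, m = b - b'})

/-- The quotient `M' = M / (⟨B - B⟩_ℝ ∩ M)`. -/
abbrev GaussQuotient (k : Type*) [Field k] (A : Finset M) : Type _ := M ⧸ gaussKernel k A

instance free_quotient_realSaturation [Module.Finite ℤ M] (L : Submodule ℤ M) :
    Module.Free ℤ (M ⧸ realSaturation L) := by
  have : Module.IsTorsionFree ℤ (M ⧸ realSaturation L) := by
    rw [Module.isTorsionFree_iff_smul_eq_zero]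
    intro n x
    obtain ⟨m, rfl⟩ := Submodule.Quotient.mk_surjective _ x
    rw [← Submodule.Quotient.mk_smul, Submodule.Quotient.mk_eq_zero,
      Submodule.Quotient.mk_eq_zero]
    intro h
    by_cases hn : n = 0
    · exact Or.inl hn
    · right
      have h' : (1 : ℝ) ⊗ₜ[ℤ] (n • m) ∈
          Submodule.span ℝ (TensorProduct.mk ℤ ℝ M 1 '' (L : Set M)) := h
      have h2 := Submodule.smul_mem _ ((n : ℝ)⁻¹) h'
      have h3 : (n : ℝ)⁻¹ • ((1 : ℝ) ⊗ₜ[ℤ] (n • m)) = (1 : ℝ) ⊗ₜ[ℤ] m := by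
        rw [TensorProduct.smul_tmul', ← TensorProduct.smul_tmul, zsmul_eq_mul, smul_eq_mul,
          mul_one, mul_inv_cancel₀ (Int.cast_ne_zero.2 hn)]
      rw [h3] at h2
      exact h2
  exact Module.free_of_finite_type_torsion_free'

instance free_gaussQuotient [Module.Finite ℤ M] (A : Finset M) :
    Module.Free ℤ (M ⧸ gaussKernel k A) :=
  free_quotient_realSaturation _

open Classical in
/-- The image `π(A)` of `A` under the projection `π : M → M'`. -/
def gaussImage (k : Type*) [Field k] (A : Finset M) : Finset (GaussQuotient k A) :=
  A.image (gaussKernel k A).mkQ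

theorem gaussImage_nonempty {A : Finset M} (hA : A.Nonempty) : (gaussImage k A).Nonempty := by
  classical
  exact hA.image _

/-- The fiber through `φ_A(t)` of the restriction to the torus of the Gauss map of `X_A`. -/
def torusGaussFiber [Infinite k] [Module.Free ℤ M] [Module.Finite ℤ M] (A : Finset M)
    (hA : A.Nonempty) (t : Torus k M) : Set (ℙ k (A → k)) :=
  {y | y ∈ Set.range (torusPoint (k := k) A hA) ∧ (toricVariety A hA).IsSmoothAt y ∧
    (toricVariety A hA).tangentSpace y = (toricVariety A hA).tangentSpace (torusPoint A hA t)}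

end Toric

end ToricGauss

end

noncomputable section

namespace ToricGauss

/-! ### Affine functions on a lattice -/

section AffineFunctions

variable {k : Type*} [Field k] {M : Type*} [AddCommGroup M]

/-! Write L = ⟨B - B⟩ (`gaussLattice`). At a torus point v of the cone over X_A the tangent space
consists of the vectors (v_u a(u)), where a runs over the (n + 1)-dimensional space of k-valued
affine functions on M (`AffinelyGenerates.tangentSpace_eq_range`). Its Plücker coordinates are
monomials: a determinant times the product of the v_{I b}, nonzero exactly when the tuple I is
spanning. Up to nonzero constants, γ is thus the monomial map with exponents in B. Differentiating
it gives rk γ = n + 1 - dim Ann, where Ann is the space of affine functions whose linear part kills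
L (`AffinelyGenerates.rankAt_add`).

The combinatorial core is an exchange argument. If u in A has a nonzero barycentric coordinate at
the member I b of a spanning tuple, then u can replace I b, so u and I b agree modulo L
(`IsSpanningTuple.sub_mem_gaussLattice`). Hence a function on A that is constant on classes modulo L
acts on affine functions by multiplying their values on A. Computing the trace of this operator in
two spanning tuples shows that the function has the same sum over both; applying it to the constant
1 shows that the function extends to an affine function. So Ann has dimension at least the number of
classes of A modulo L, which is at least #π(A). This is the rank bound.

In the torus function field, the degree 0 monomials belonging to K(X_A) have exponent lattice M,
those belonging to the field of the Gauss image have exponent lattice L. If γ is separable, a p-th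
root z^m of an element z^(pm) of the smaller field already lies in it, so M / L has no p-torsion.
Then Ann descends to M', and rank M' + 1 ≤ #π(A) ≤ #(A mod L) ≤ dim Ann ≤ rank M' + 1. Therefore
π(A) is affinely independent, X_{π(A)} is the full projective space, and the classes of A modulo L
are those of π.

Finally, two torus points have the same tangent space exactly when their coordinate ratios are
constant on classes modulo L. A fiber is thus a linearly embedded copy of the torus of X_{π(A)}, and
its closure is a linear subspace (`AffinelyGenerates.torusGaussFiber_eq`,
`zariskiClosure_map_image`). -/

/-- `A` generates `M` as an affine lattice. -/
def AffinelyGenerates (A : Finset M) : Prop :=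
  Submodule.span ℤ (Set.range fun u : A => ((u : M), (1 : ℤ))) = ⊤

/-- The points m with (m, 1) in the span form an affine subspace containing A, hence all of M; then
(m, d) = (m, 1) + (d - 1)(0, 1). -/
theorem AffinelyGenerates.of_affineSpan_eq_top {A : Finset M}
    (h : affineSpan ℤ (A : Set M) = ⊤) : AffinelyGenerates A := by
  set S := Submodule.span ℤ (Set.range fun u : A => ((u : M), (1 : ℤ))) with hS
  let T : AffineSubspace ℤ M :=
    { carrier := {m | (m, (1 : ℤ)) ∈ S}
      smul_vsub_vadd_mem' := by
        intro c p q r hp hq hr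
        have := S.add_mem (S.smul_mem c (S.sub_mem hp hq)) hr
        simpa using this }
  have hT : ∀ m : M, (m, (1 : ℤ)) ∈ S := by
    have h1 : affineSpan ℤ (A : Set M) ≤ T :=
      affineSpan_le.2 fun u hu => Submodule.subset_span ⟨⟨u, hu⟩, rfl⟩
    rw [h] at h1
    exact fun m => h1 (AffineSubspace.mem_top ℤ M m)
  refine Submodule.eq_top_iff'.2 ?_
  rintro ⟨m, d⟩
  have := S.add_mem (hT m) (S.smul_mem (d - 1) (hT 0))
  simpa using this

theorem exists_comp_eq_of_ker_le {P Q N : Type*} [AddCommGroup P] [AddCommGroup Q] [AddCommGroup N]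
    (q : P →ₗ[ℤ] Q) (hq : Function.Surjective q) (g : P →ₗ[ℤ] N)
    (h : LinearMap.ker q ≤ LinearMap.ker g) : ∃ f : Q →ₗ[ℤ] N, ∀ x, f (q x) = g x :=
  ⟨(LinearMap.ker q).liftQ g h ∘ₗ (q.quotKerEquivOfSurjective hq).symm.toLinearMap, fun x => by
    have : (q.quotKerEquivOfSurjective hq).symm (q x) = (LinearMap.ker q).mkQ x := by
      rw [LinearEquiv.symm_apply_eq]; rfl
    simp [this]⟩

/-- Splitting an integer relation into positive and negative parts makes it an equality between two
exponent vectors, the shape of a binomial equation. -/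
theorem linearCombination_int_eq_sub {ι : Type*} [Fintype ι] {N : Type*} [AddCommGroup N]
    (g : ι → N) (r : ι →₀ ℤ) :
    Finsupp.linearCombination ℤ g r =
      ∑ u, (r.mapRange Int.toNat rfl) u • g u - ∑ u, ((-r).mapRange Int.toNat rfl) u • g u := by
  rw [Finsupp.linearCombination_apply, Finsupp.sum_fintype _ _ (by simp),
    ← Finset.sum_sub_distrib]
  refine Finset.sum_congr rfl fun u _ => ?_
  rw [Finsupp.mapRange_apply, Finsupp.mapRange_apply, ← natCast_zsmul, ← natCast_zsmul,
    ← sub_smul, Finsupp.neg_apply]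
  congr 1
  omega

/-- A function on `A` which respects the affine relations in `A` is the restriction of a
homomorphism. -/
theorem AffinelyGenerates.exists_hom {A : Finset M} (hA : AffinelyGenerates A) {N : Type*}
    [AddCommGroup N] (g : A → N)
    (h : ∀ s s' : A →₀ ℕ, ∑ u, s u • ((u : M), (1 : ℤ)) = ∑ u, s' u • ((u : M), (1 : ℤ)) →
      ∑ u, s u • g u = ∑ u, s' u • g u) :
    ∃ f : M × ℤ →ₗ[ℤ] N, ∀ u : A, f ((u : M), 1) = g u := by
  obtain ⟨f, hf⟩ := exists_comp_eq_of_ker_le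
    (Finsupp.linearCombination ℤ (fun u : A => ((u : M), (1 : ℤ))))
    (LinearMap.range_eq_top.1 (by rw [Finsupp.range_linearCombination]; exact hA))
    (Finsupp.linearCombination ℤ g) (fun r hr => by
      rw [LinearMap.mem_ker, linearCombination_int_eq_sub, sub_eq_zero] at hr ⊢
      exact h _ _ hr)
  refine ⟨f, fun u => ?_⟩
  simpa using hf (Finsupp.single u 1)

/-- The map (m, d) ↦ m - d u₀ sends the generators (u, 1) into S and (m, 0) to m. -/
theorem AffinelyGenerates.mem_of_forall_sub_mem {A : Finset M} (hA : AffinelyGenerates A)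
    (S : Submodule ℤ M) (u₀ : M) (h : ∀ u ∈ A, u - u₀ ∈ S) (m : M) : m ∈ S := by
  have h1 : Submodule.span ℤ (Set.range fun u : A => ((u : M), (1 : ℤ))) ≤
      S.comap (LinearMap.fst ℤ M ℤ - (LinearMap.snd ℤ M ℤ).smulRight u₀) := by
    rw [Submodule.span_le]
    rintro _ ⟨u, rfl⟩
    simpa using h u u.2
  rw [hA] at h1
  simpa using h1 (Submodule.mem_top (x := (m, (0 : ℤ))))

theorem AffinelyGenerates.image {A : Finset M} (hA : AffinelyGenerates A) {M₁ : Type*}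
    [AddCommGroup M₁] [DecidableEq M₁] (f : M →ₗ[ℤ] M₁) (hf : Function.Surjective f) :
    AffinelyGenerates (A.image f) := by
  unfold AffinelyGenerates at *
  rw [eq_top_iff]
  have : (⊤ : Submodule ℤ (M × ℤ)).map (f.prodMap LinearMap.id) = ⊤ := by
    rw [Submodule.map_top, LinearMap.range_eq_top]
    exact Function.Surjective.prodMap hf Function.surjective_id
  rw [← this, ← hA, Submodule.map_span]
  refine Submodule.span_mono ?_
  rintro _ ⟨_, ⟨u, rfl⟩, rfl⟩
  exact ⟨⟨f u, Finset.mem_image_of_mem f u.2⟩, rfl⟩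

variable (k M) in
/-- The affine functions `m ↦ f m + c` on the lattice `M` with values in `k`. -/
abbrev AffFun : Type _ := (M →ₗ[ℤ] k) × k

/-- The evaluation of affine functions at a point. -/
def affEval (m : M) : AffFun k M →ₗ[k] k where
  toFun a := a.1 m + a.2
  map_add' a b := by simp; ring
  map_smul' c a := by simp; ring

theorem affEval_apply (m : M) (a : AffFun k M) : affEval m a = a.1 m + a.2 := rfl

theorem sum_affEval {ι : Type*} [Fintype ι] (u : ι → M) (a : AffFun k M) :
    ∑ b, affEval (u b) a = a.1 (∑ b, u b) + Fintype.card ι * a.2 := by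
  simp [affEval_apply, Finset.sum_add_distrib]

/-- The extension of an affine function to a homomorphism `M × ℤ → k`. -/
def AffFun.toHom (a : AffFun k M) : M × ℤ →ₗ[ℤ] k :=
  a.1.coprod (LinearMap.toSpanSingleton ℤ k a.2)

theorem AffFun.toHom_apply (a : AffFun k M) (m : M) : a.toHom (m, 1) = affEval m a := by
  simp [AffFun.toHom, affEval_apply]

theorem AffinelyGenerates.ext {A : Finset M} (hA : AffinelyGenerates A) {a : AffFun k M}
    (h : ∀ u ∈ A, affEval u a = 0) : a = 0 := by
  have h1 : a.toHom = 0 := by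
    refine LinearMap.ext_on_range (v := fun u : A => ((u : M), (1 : ℤ))) hA ?_
    intro u
    rw [AffFun.toHom_apply, h u u.2]
    simp
  have h2 : a.2 = 0 := by simpa [AffFun.toHom] using LinearMap.congr_fun h1 (0, 1)
  refine Prod.ext (LinearMap.ext fun m => ?_) h2
  simpa [AffFun.toHom] using LinearMap.congr_fun h1 (m, 0)

theorem AffinelyGenerates.exists_affFun {A : Finset M} (hA : AffinelyGenerates A) (g : A → k)
    (h : ∀ s s' : A →₀ ℕ, ∑ u, s u • ((u : M), (1 : ℤ)) = ∑ u, s' u • ((u : M), (1 : ℤ)) →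
      ∑ u, s u • g u = ∑ u, s' u • g u) :
    ∃ a : AffFun k M, ∀ u : A, affEval (u : M) a = g u := by
  obtain ⟨f, hf⟩ := hA.exists_hom g h
  refine ⟨(f ∘ₗ LinearMap.inl ℤ M ℤ, f (0, 1)), fun u => ?_⟩
  rw [← hf u, affEval_apply]
  simp [← map_add]

/-! ### Tuples of points spanning the affine space -/

/-- The tuple `u` is affinely spanning: only the zero affine function vanishes on it. -/
def IsSpanningTuple (k : Type*) [Field k] {N : ℕ} (u : Fin N → M) : Prop :=
  ∀ a : AffFun k M, (∀ b, affEval (u b) a = 0) → a = 0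

theorem isSpanningTuple_iff_affineSpan_eq_top {N : ℕ} (u : Fin (N + 1) → M) :
    IsSpanningTuple k u ↔ affineSpan k (Set.range fun i => (1 : k) ⊗ₜ[ℤ] u i) = ⊤ := by
  constructor
  · intro h
    by_contra hne
    have hu0 : (1 : k) ⊗ₜ[ℤ] u 0 ∈ affineSpan k (Set.range fun i => (1 : k) ⊗ₜ[ℤ] u i) :=
      subset_affineSpan _ _ ⟨0, rfl⟩
    have hdir : (affineSpan k (Set.range fun i => (1 : k) ⊗ₜ[ℤ] u i)).direction < ⊤ := by
      rw [lt_top_iff_ne_top]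
      intro hd
      exact hne ((AffineSubspace.direction_eq_top_iff_of_nonempty ⟨_, hu0⟩).1 hd)
    -- A nonzero functional killing the direction of a proper affine span, normalised at `u 0`, is
    -- an affine function vanishing on the whole tuple.
    obtain ⟨θ, hθ, hle⟩ := Submodule.exists_le_ker_of_lt_top _ hdir
    apply hθ
    let a : AffFun k M := ((θ.restrictScalars ℤ) ∘ₗ TensorProduct.mk ℤ k M 1,
      - θ ((1 : k) ⊗ₜ[ℤ] u 0))
    have ha : a = 0 := h a fun b => by
      have h1 := hle (AffineSubspace.vsub_mem_direction
        (subset_affineSpan k _ (Set.mem_range_self b) :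
          (1 : k) ⊗ₜ[ℤ] u b ∈ affineSpan k (Set.range fun i => (1 : k) ⊗ₜ[ℤ] u i)) hu0)
      rw [LinearMap.mem_ker, vsub_eq_sub, map_sub] at h1
      change θ _ + -θ _ = 0
      rw [← sub_eq_add_neg]
      exact h1
    refine LinearMap.ext fun x => ?_
    induction x with
    | zero => simp
    | add x y hx hy => rw [map_add, hx, hy]; simp
    | tmul c m =>
      have h1 : θ ((1 : k) ⊗ₜ[ℤ] m) = 0 := LinearMap.congr_fun (congrArg Prod.fst ha) m
      have h2 : c ⊗ₜ[ℤ] m = c • ((1 : k) ⊗ₜ[ℤ] m) := by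
        rw [TensorProduct.smul_tmul', smul_eq_mul, mul_one]
      rw [h2, map_smul, h1]
      simp
  · intro h a ha
    let θ : k ⊗[ℤ] M →ₗ[k] k := TensorProduct.AlgebraTensorModule.lift
      ((LinearMap.id : k →ₗ[k] k).smulRight a.1)
    have hθ : ∀ m : M, θ (1 ⊗ₜ m) = a.1 m := by
      intro m
      simp [θ]
    let T : AffineSubspace k (k ⊗[ℤ] M) :=
      { carrier := {x | θ x + a.2 = 0}
        smul_vsub_vadd_mem' := by
          intro c p q r hp hq hr
          change θ p + a.2 = 0 at hp
          change θ q + a.2 = 0 at hq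
          change θ r + a.2 = 0 at hr
          change θ (c • (p - q) + r) + a.2 = 0
          rw [map_add, map_smul, map_sub, smul_eq_mul]
          linear_combination c * hp - c * hq + hr }
    have h1 : affineSpan k (Set.range fun i => (1 : k) ⊗ₜ[ℤ] u i) ≤ T := by
      refine affineSpan_le.2 ?_
      rintro _ ⟨b, rfl⟩
      change θ _ + a.2 = 0
      rw [hθ]
      exact ha b
    rw [h] at h1
    have h2 : ∀ x, θ x + a.2 = 0 := fun x => h1 (AffineSubspace.mem_top k _ x)
    have h3 : a.2 = 0 := by simpa using h2 0
    refine Prod.ext (LinearMap.ext fun m => ?_) h3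
    have := h2 (1 ⊗ₜ m)
    rw [hθ, h3, add_zero] at this
    simpa using this

theorem mem_basisSums_iff {A : Finset M} {N : ℕ} (hN : N = Module.finrank ℤ M + 1) (m : M) :
    m ∈ basisSums k A ↔ ∃ I : Fin N → A, IsSpanningTuple k (fun b => (I b : M)) ∧
      m = ∑ b, (I b : M) := by
  subst hN
  constructor
  · rintro ⟨u, hu, hs, rfl⟩
    exact ⟨fun i => ⟨u i, hu i⟩, (isSpanningTuple_iff_affineSpan_eq_top _).2 hs, rfl⟩
  · rintro ⟨I, hI, rfl⟩
    exact ⟨fun b => I b, fun b => (I b).2, (isSpanningTuple_iff_affineSpan_eq_top _).1 hI, rfl⟩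

/-- For an affine function vanishing on the new tuple, the expansion of its value at m reduces to
the term at b, so it vanishes at the discarded point too. -/
theorem IsSpanningTuple.update {N : ℕ} {u : Fin N → M} (hu : IsSpanningTuple k u) {m : M} {c : Fin N → k}
    (hc : ∀ a : AffFun k M, affEval m a = ∑ b, c b * affEval (u b) a) {b : Fin N} (hb : c b ≠ 0) :
    IsSpanningTuple k (Function.update u b m) := by
  intro a ha
  have h1 : ∀ b', b' ≠ b → affEval (u b') a = 0 := fun b' hb' => by
    simpa [Function.update_of_ne hb'] using ha b'
  refine hu a fun b' => ?_
  by_cases hb' : b' = b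
  · subst hb'
    have h2 := ha b'
    rw [Function.update_self, hc, Finset.sum_eq_single b' (fun b'' _ h => by rw [h1 b'' h, mul_zero])
      (by simp)] at h2
    exact (mul_eq_zero.1 h2).resolve_left hb
  · exact h1 b' hb'

variable [Module.Free ℤ M] [Module.Finite ℤ M]

instance : Module.Finite k (M →ₗ[ℤ] k) :=
  Module.Finite.equiv ((Module.Free.chooseBasis ℤ M).constr k)

variable (k M) in
theorem finrank_linearMap_int : Module.finrank k (M →ₗ[ℤ] k) = Module.finrank ℤ M := by
  rw [← ((Module.Free.chooseBasis ℤ M).constr k).finrank_eq, Module.finrank_fintype_fun_eq_card,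
    Module.finrank_eq_card_chooseBasisIndex]

variable (k M) in
theorem finrank_affFun : Module.finrank k (AffFun k M) = Module.finrank ℤ M + 1 := by
  rw [Module.finrank_prod, finrank_linearMap_int, Module.finrank_self]

section Tuple

variable {N : ℕ} {u : Fin N → M}

/-- The values of affine functions on a spanning tuple of minimal length are coordinates. -/
def IsSpanningTuple.equiv (hu : IsSpanningTuple k u) (hN : N = Module.finrank ℤ M + 1) :
    AffFun k M ≃ₗ[k] (Fin N → k) :=
  LinearEquiv.ofInjectiveOfFinrankEq (LinearMap.pi fun b => affEval (u b))
    ((injective_iff_map_eq_zero _).2 fun a ha => hu a fun b => congrFun ha b)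
    (by rw [finrank_affFun, Module.finrank_fin_fun, hN])

theorem IsSpanningTuple.equiv_apply (hu : IsSpanningTuple k u) (hN : N = Module.finrank ℤ M + 1)
    (a : AffFun k M) (b : Fin N) : hu.equiv hN a b = affEval (u b) a := rfl

theorem IsSpanningTuple.affEval_equiv_symm (hu : IsSpanningTuple k u)
    (hN : N = Module.finrank ℤ M + 1) (x : Fin N → k) (b : Fin N) :
    affEval (u b) ((hu.equiv hN).symm x) = x b := by
  rw [← hu.equiv_apply hN, LinearEquiv.apply_symm_apply]

/-- The barycentric coordinates of a lattice point with respect to a spanning tuple. -/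
theorem IsSpanningTuple.exists_coords (hu : IsSpanningTuple k u)
    (hN : N = Module.finrank ℤ M + 1) (m : M) :
    ∃ c : Fin N → k, ∀ a : AffFun k M, affEval m a = ∑ b, c b * affEval (u b) a := by
  let θ : (Fin N → k) →ₗ[k] k := affEval m ∘ₗ (hu.equiv hN).symm.toLinearMap
  refine ⟨fun b => θ (Pi.single b 1), fun a => ?_⟩
  have h1 : affEval m a = θ (hu.equiv hN a) := by simp [θ]
  rw [h1, LinearMap.pi_apply_eq_sum_univ]
  refine Finset.sum_congr rfl fun b _ => ?_
  rw [smul_eq_mul, mul_comm, hu.equiv_apply]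
  congr 2
  ext i
  simp [Pi.single_apply, eq_comm]

end Tuple

/-- No nonzero affine function vanishes on A, so the evaluations at points of A span the dual space;
a basis chosen among them has n + 1 members. -/
theorem AffinelyGenerates.exists_isSpanningTuple {A : Finset M} (hA : AffinelyGenerates A) {N : ℕ}
    (hN : N = Module.finrank ℤ M + 1) :
    ∃ I : Fin N → A, IsSpanningTuple k (fun b => (I b : M)) := by
  obtain ⟨κ, f, hf, hsp, hli⟩ :=
    exists_linearIndependent' k (fun u : A => (affEval (u : M) : Module.Dual k (AffFun k M)))
  have htop : Submodule.span k
      (Set.range fun u : A => (affEval (u : M) : Module.Dual k (AffFun k M))) = ⊤ := by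
    rw [← Subspace.dualCoannihilator_dualAnnihilator_eq (W := Submodule.span k _)]
    rw [Submodule.dualAnnihilator_eq_top_iff, eq_bot_iff]
    intro a ha
    refine hA.ext fun u hu => ?_
    rw [Submodule.mem_dualCoannihilator] at ha
    exact ha _ (Submodule.subset_span ⟨⟨u, hu⟩, rfl⟩)
  have : Finite κ := Finite.of_injective f hf
  have := Fintype.ofFinite κ
  rw [htop] at hsp
  let bas := Module.Basis.mk hli hsp.ge
  have hcard : Fintype.card κ = N := by
    rw [← Module.finrank_eq_card_basis bas, Subspace.dual_finrank_eq, finrank_affFun, hN]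
  refine ⟨fun b => f ((Fintype.equivFinOfCardEq hcard).symm b), fun a ha => ?_⟩
  have h1 : ∀ θ : Module.Dual k (AffFun k M), θ a = 0 := by
    intro θ
    have h2 : Module.Dual.eval k _ a = 0 := bas.ext fun i => by
      have := ha (Fintype.equivFinOfCardEq hcard i)
      simpa [bas] using this
    exact LinearMap.congr_fun h2 θ
  exact (Module.forall_dual_apply_eq_zero_iff k a).1 h1

end AffineFunctions

/-! ### The lattice generated by the differences of the sums of spanning tuples -/

section GaussLattice

variable {k : Type*} [Field k] {M : Type*} [AddCommGroup M]

/-- The subgroup `⟨B - B⟩` of `M`. -/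
def gaussLattice (k : Type*) [Field k] (A : Finset M) : Submodule ℤ M :=
  Submodule.span ℤ {m | ∃ b ∈ basisSums k A, ∃ b' ∈ basisSums k A, m = b - b'}

theorem sum_sub_sum_mem_gaussLattice {A : Finset M} {N : ℕ} (hN : N = Module.finrank ℤ M + 1)
    {I J : Fin N → A} (hI : IsSpanningTuple k fun b => (I b : M))
    (hJ : IsSpanningTuple k fun b => (J b : M)) :
    ∑ b, (I b : M) - ∑ b, (J b : M) ∈ gaussLattice k A :=
  Submodule.subset_span ⟨_, (mem_basisSums_iff hN _).2 ⟨I, hI, rfl⟩, _,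
    (mem_basisSums_iff hN _).2 ⟨J, hJ, rfl⟩, rfl⟩

theorem gaussLattice_le_iff {A : Finset M} {N : ℕ} (hN : N = Module.finrank ℤ M + 1)
    {S : Submodule ℤ M} :
    gaussLattice k A ≤ S ↔ ∀ I J : Fin N → A, IsSpanningTuple k (fun b => (I b : M)) →
      IsSpanningTuple k (fun b => (J b : M)) → ∑ b, (I b : M) - ∑ b, (J b : M) ∈ S := by
  constructor
  · exact fun h I J hI hJ => h (sum_sub_sum_mem_gaussLattice hN hI hJ)
  · intro h
    rw [gaussLattice, Submodule.span_le]
    rintro _ ⟨b, hb, b', hb', rfl⟩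
    obtain ⟨I, hI, rfl⟩ := (mem_basisSums_iff hN _).1 hb
    obtain ⟨J, hJ, rfl⟩ := (mem_basisSums_iff hN _).1 hb'
    exact h I J hI hJ

/-- The exchange property: a point `u` of `A` can be exchanged for each member of a spanning tuple
with respect to which it has a nonzero coordinate. -/
theorem IsSpanningTuple.sub_mem_gaussLattice {A : Finset M} {N : ℕ}
    (hN : N = Module.finrank ℤ M + 1) {I : Fin N → A} (hI : IsSpanningTuple k fun b => (I b : M))
    {u : A} {c : Fin N → k}
    (hc : ∀ a : AffFun k M, affEval (u : M) a = ∑ b, c b * affEval (I b : M) a) {b : Fin N}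
    (hb : c b ≠ 0) : (u : M) - I b ∈ gaussLattice k A := by
  have h1 := hI.update hc hb
  have h2 : Function.update (fun b => (I b : M)) b (u : M) =
      fun b' => (Function.update I b u b' : M) := by
    ext b'
    by_cases h : b' = b
    · subst h; simp
    · simp [Function.update_of_ne h]
  -- The two spanning tuples differ only at b, so the difference of their sums is u - I b.
  have h3 := sum_sub_sum_mem_gaussLattice hN (h2 ▸ h1) hI
  rw [← h2, ← Finset.sum_sub_distrib, Finset.sum_eq_single b] at h3
  · simpa using h3
  · intro b' _ hb'
    simp [Function.update_of_ne hb']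
  · simp

variable (k) in
/-- The affine functions which are constant on `B`. -/
def gaussAnnihilator (A : Finset M) : Submodule k (AffFun k M) where
  carrier := {a | ∀ m ∈ gaussLattice k A, a.1 m = 0}
  add_mem' := by
    intro a a' h h' m hm
    simp [h m hm, h' m hm]
  zero_mem' := by
    intro m _
    rfl
  smul_mem' := by
    intro c a h m hm
    simp [h m hm]

theorem mem_gaussAnnihilator_iff {A : Finset M} {N : ℕ} (hN : N = Module.finrank ℤ M + 1)
    {a : AffFun k M} :
    a ∈ gaussAnnihilator k A ↔ ∀ I J : Fin N → A, IsSpanningTuple k (fun b => (I b : M)) →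
      IsSpanningTuple k (fun b => (J b : M)) →
        ∑ b, affEval (I b : M) a = ∑ b, affEval (J b : M) a := by
  have h1 : a ∈ gaussAnnihilator k A ↔ gaussLattice k A ≤ LinearMap.ker a.1 := Iff.rfl
  rw [h1, gaussLattice_le_iff hN]
  simp only [sum_affEval, add_left_inj, LinearMap.mem_ker, map_sub, sub_eq_zero]

variable [Module.Free ℤ M] [Module.Finite ℤ M]

section Scale

variable {A : Finset M} {N : ℕ} {I J : Fin N → A}

/-- The endomorphism of the space of affine functions which multiplies the values on a spanning
tuple by given scalars. -/
def IsSpanningTuple.scale {u : Fin N → M} (hu : IsSpanningTuple k u)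
    (hN : N = Module.finrank ℤ M + 1) (μ : Fin N → k) : AffFun k M →ₗ[k] AffFun k M :=
  (hu.equiv hN).symm.conj (Matrix.toLin' (Matrix.diagonal μ))

theorem IsSpanningTuple.affEval_scale {u : Fin N → M} (hu : IsSpanningTuple k u)
    (hN : N = Module.finrank ℤ M + 1) (μ : Fin N → k) (a : AffFun k M) (b : Fin N) :
    affEval (u b) (hu.scale hN μ a) = μ b * affEval (u b) a := by
  simp [IsSpanningTuple.scale, LinearEquiv.conj_apply, hu.affEval_equiv_symm hN,
    Matrix.mulVec_diagonal, hu.equiv_apply hN]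

theorem IsSpanningTuple.trace_scale {u : Fin N → M} (hu : IsSpanningTuple k u)
    (hN : N = Module.finrank ℤ M + 1) (μ : Fin N → k) :
    LinearMap.trace k _ (hu.scale hN μ) = ∑ b, μ b := by
  rw [IsSpanningTuple.scale, LinearMap.trace_conj', Matrix.trace_toLin'_eq, Matrix.trace_diagonal]

variable {lam : A → k}

/-- Expand u in barycentric coordinates: by exchange, only members I b congruent to u modulo ⟨B - B⟩
contribute, and there lam takes the value lam u. The operator is thus multiplication by lam on all
of A and does not depend on I. -/
theorem IsSpanningTuple.affEval_scale_of_mem (hN : N = Module.finrank ℤ M + 1)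
    (hI : IsSpanningTuple k fun b => (I b : M))
    (hlam : ∀ u u' : A, (u : M) - u' ∈ gaussLattice k A → lam u = lam u') (a : AffFun k M) (u : A) :
    affEval (u : M) (hI.scale hN (fun b => lam (I b)) a) = lam u * affEval (u : M) a := by
  obtain ⟨c, hc⟩ := hI.exists_coords hN (u : M)
  rw [hc, hc, Finset.mul_sum]
  refine Finset.sum_congr rfl fun b _ => ?_
  rw [hI.affEval_scale hN]
  by_cases hb : c b = 0
  · simp [hb]
  · rw [hlam u (I b) (hI.sub_mem_gaussLattice hN hc hb)]
    ring

/-- A function on `A` which is constant on the classes modulo `⟨B - B⟩` has the same sum over all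
spanning tuples. -/
theorem sum_eq_sum_of_isSpanningTuple (hN : N = Module.finrank ℤ M + 1)
    (hI : IsSpanningTuple k fun b => (I b : M)) (hJ : IsSpanningTuple k fun b => (J b : M))
    (hlam : ∀ u u' : A, (u : M) - u' ∈ gaussLattice k A → lam u = lam u') :
    ∑ b, lam (I b) = ∑ b, lam (J b) := by
  -- Both sums are traces of one endomorphism, diagonalised in the two coordinate systems.
  rw [← hI.trace_scale hN, ← hJ.trace_scale hN]
  congr 1
  refine LinearMap.ext fun a => (hJ.equiv hN).injective (funext fun b => ?_)
  rw [hJ.equiv_apply, hJ.equiv_apply, hI.affEval_scale_of_mem hN hlam, hJ.affEval_scale hN]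

end Scale

theorem AffinelyGenerates.card_image_le_finrank_gaussAnnihilator {A : Finset M}
    (hA : AffinelyGenerates A) [DecidableEq (M ⧸ gaussLattice k A)] :
    (A.image (gaussLattice k A).mkQ).card ≤ Module.finrank k (gaussAnnihilator k A) := by
  obtain ⟨I, hI⟩ := hA.exists_isSpanningTuple (k := k) rfl
  let cl : A → A.image (gaussLattice k A).mkQ := fun u => ⟨_, Finset.mem_image_of_mem _ u.2⟩
  have hcl : ∀ u u' : A, (u : M) - u' ∈ gaussLattice k A → cl u = cl u' := fun u u' h =>
    Subtype.ext ((Submodule.Quotient.eq _).2 h)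
  let ψ : (A.image (gaussLattice k A).mkQ → k) →ₗ[k] AffFun k M :=
    (hI.equiv rfl).symm.toLinearMap ∘ₗ LinearMap.pi fun b => LinearMap.proj (cl (I b))
  have hψ : ∀ e (u : A), affEval (u : M) (ψ e) = e (cl u) := by
    intro e u
    -- The pair `(0, 1)` is the constant function 1; its image under the scaling operator takes the
    -- value `e (cl u)` at every u in A, not only on the tuple.
    have h1 : ψ e = hI.scale rfl (fun b => e (cl (I b))) (0, 1) := by
      refine (hI.equiv rfl).injective (funext fun b => ?_)
      rw [hI.equiv_apply, hI.equiv_apply, hI.affEval_scale rfl]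
      change affEval (I b : M) ((hI.equiv rfl).symm _) = _
      rw [hI.affEval_equiv_symm rfl]
      simp [affEval_apply]
    rw [h1, hI.affEval_scale_of_mem rfl (lam := fun u => e (cl u))
      (fun u u' h => congrArg e (hcl u u' h))]
    simp [affEval_apply]
  have hmem : ∀ e, ψ e ∈ gaussAnnihilator k A := by
    intro e
    rw [mem_gaussAnnihilator_iff rfl]
    intro J J' hJ hJ'
    simp only [hψ]
    exact sum_eq_sum_of_isSpanningTuple (lam := fun u => e (cl u)) rfl hJ hJ'
      fun u u' h => congrArg e (hcl u u' h)
  have hinj : Function.Injective (ψ.codRestrict _ hmem) := by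
    rw [injective_iff_map_eq_zero]
    intro e he
    have he' : ψ e = 0 := congrArg Subtype.val he
    ext ⟨x, hx⟩
    obtain ⟨u, hu, rfl⟩ := Finset.mem_image.1 hx
    have := hψ e ⟨u, hu⟩
    rw [he', map_zero] at this
    exact this.symm
  simpa using LinearMap.finrank_le_finrank_of_injective hinj

-- If m is not torsion modulo L, some coordinate on the free quotient of M / L by its torsion is
-- nonzero at m. Its real extension kills the real span of L but not m.
omit [Module.Free ℤ M] in
theorem exists_smul_mem_of_mem_realSaturation {L : Submodule ℤ M} {m : M}
    (hm : m ∈ realSaturation L) : ∃ n : ℕ, 0 < n ∧ n • m ∈ L := by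
  by_contra! hcon
  let T := Submodule.torsion ℤ (M ⧸ L)
  have : Module.IsTorsionFree ℤ ((M ⧸ L) ⧸ T) := inferInstance
  have : Module.Free ℤ ((M ⧸ L) ⧸ T) := Module.free_of_finite_type_torsion_free'
  let p : M →ₗ[ℤ] (M ⧸ L) ⧸ T := T.mkQ ∘ₗ L.mkQ
  have hpm : p m ≠ 0 := by
    intro h
    have h1 : L.mkQ m ∈ T := by
      have : T.mkQ (L.mkQ m) = 0 := h
      simpa using this
    obtain ⟨⟨c, hc⟩, hcm⟩ := h1
    have hc0 : c ≠ 0 := nonZeroDivisors.ne_zero hc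
    have h2 : c • m ∈ L := by
      rw [← Submodule.Quotient.mk_eq_zero]
      exact hcm
    refine hcon c.natAbs (Int.natAbs_pos.2 hc0) ?_
    rw [← natCast_zsmul]
    rcases Int.natAbs_eq c with h | h
    · rw [← h]; exact h2
    · have : (c.natAbs : ℤ) = -c := by omega
      rw [this, neg_smul]
      exact L.neg_mem h2
  let bas := Module.Free.chooseBasis ℤ ((M ⧸ L) ⧸ T)
  obtain ⟨i, hi⟩ : ∃ i, bas.repr (p m) i ≠ 0 := by
    by_contra! h'
    exact hpm (bas.repr.map_eq_zero_iff.1 (Finsupp.ext h'))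
  let ψ : M →ₗ[ℤ] ℝ := (Algebra.linearMap ℤ ℝ) ∘ₗ bas.coord i ∘ₗ p
  let θ : ℝ ⊗[ℤ] M →ₗ[ℝ] ℝ := TensorProduct.AlgebraTensorModule.lift
    ((LinearMap.id : ℝ →ₗ[ℝ] ℝ).smulRight ψ)
  have hθ : ∀ x : M, θ (1 ⊗ₜ x) = ψ x := by
    intro x
    simp [θ]
  have hspan : Submodule.span ℝ (TensorProduct.mk ℤ ℝ M 1 '' (L : Set M)) ≤ LinearMap.ker θ := by
    rw [Submodule.span_le]
    rintro _ ⟨l, hl, rfl⟩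
    change θ (1 ⊗ₜ l) = 0
    have : L.mkQ l = 0 := by simpa using hl
    rw [hθ]
    simp [ψ, p, this]
  have h1 : θ (1 ⊗ₜ m) = 0 := hspan hm
  rw [hθ] at h1
  exact hi (by simpa [ψ] using h1)

omit [Module.Free ℤ M] in
/-- If `M / L` has no torsion of order the characteristic, then a homomorphism to `k` vanishing on
`L` vanishes on its saturation. -/
theorem eq_zero_of_mem_realSaturation {L : Submodule ℤ M}
    (hL : ∀ p : ℕ, p.Prime → (p : k) = 0 → ∀ m : M, p • m ∈ L → m ∈ L) {f : M →ₗ[ℤ] k}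
    (hf : ∀ m ∈ L, f m = 0) {m : M} (hm : m ∈ realSaturation L) : f m = 0 := by
  classical
  have hex := exists_smul_mem_of_mem_realSaturation hm
  obtain ⟨hpos, hmem⟩ := Nat.find_spec hex
  set n := Nat.find hex with hn
  have h1 : (n : k) * f m = 0 := by
    rw [← nsmul_eq_mul, ← map_nsmul]
    exact hf _ hmem
  -- If the least multiplier n vanished in k, the characteristic p would divide n, and absence of
  -- p-torsion would give the smaller multiplier n / p.
  refine (mul_eq_zero.1 h1).resolve_left fun h0 => ?_
  have hdvd : ringChar k ∣ n := (ringChar.spec k n).1 h0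
  have hc0 : ringChar k ≠ 0 := by
    intro h
    rw [h, zero_dvd_iff] at hdvd
    omega
  have hprime : (ringChar k).Prime := (CharP.char_is_prime_or_zero k (ringChar k)).resolve_right hc0
  obtain ⟨d, hd⟩ := hdvd
  have hd0 : 0 < d := Nat.pos_of_ne_zero fun h => by
    rw [h, mul_zero] at hd
    omega
  have h2 : d • m ∈ L := by
    refine hL _ hprime ((ringChar.spec k _).2 dvd_rfl) _ ?_
    rw [smul_smul, ← hd]
    exact hmem
  have h3 : n ≤ d := Nat.find_min' hex ⟨hd0, h2⟩
  have h4 := hprime.two_le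
  nlinarith

-- A linear part killing ⟨B - B⟩ also kills its saturation, so these affine functions are pulled
-- back from M'.
omit [Module.Free ℤ M] in
theorem finrank_gaussAnnihilator_le {A : Finset M}
    (hL : ∀ p : ℕ, p.Prime → (p : k) = 0 → ∀ m : M,
      p • m ∈ gaussLattice k A → m ∈ gaussLattice k A) :
    Module.finrank k (gaussAnnihilator k A) ≤ Module.finrank ℤ (GaussQuotient k A) + 1 := by
  rw [← finrank_affFun k (GaussQuotient k A)]
  let ψ : AffFun k (GaussQuotient k A) →ₗ[k] AffFun k M :=
    LinearMap.prodMap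
      { toFun := fun f => f ∘ₗ (gaussKernel k A).mkQ
        map_add' := fun _ _ => rfl
        map_smul' := fun _ _ => rfl } LinearMap.id
  have h1 : gaussAnnihilator k A ≤ LinearMap.range ψ := by
    intro a ha
    refine ⟨((gaussKernel k A).liftQ a.1 fun m hm =>
      eq_zero_of_mem_realSaturation hL ha hm, a.2), ?_⟩
    refine Prod.ext (LinearMap.ext fun m => ?_) rfl
    rfl
  exact (Submodule.finrank_mono h1).trans (LinearMap.finrank_range_le ψ)

theorem AffinelyGenerates.finrank_lt_card {A : Finset M} (hA : AffinelyGenerates A) :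
    Module.finrank ℤ M + 1 ≤ A.card := by
  have h1 := finrank_range_le_card (R := ℤ) (fun u : A => ((u : M), (1 : ℤ)))
  rw [Set.finrank, hA, finrank_top, Module.finrank_prod, Module.finrank_self,
    Fintype.card_coe] at h1
  exact h1

omit [Module.Free ℤ M] [Module.Finite ℤ M] in
theorem le_realSaturation (L : Submodule ℤ M) : L ≤ realSaturation L :=
  fun m hm => Submodule.subset_span ⟨m, hm, rfl⟩

omit [Module.Free ℤ M] [Module.Finite ℤ M] in
theorem gaussImage_eq_image (A : Finset M) [DecidableEq (M ⧸ gaussKernel k A)] :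
    gaussImage k A = A.image (gaussKernel k A).mkQ := by
  unfold gaussImage
  congr
  exact Subsingleton.elim _ _

omit [Module.Free ℤ M] [Module.Finite ℤ M] in
theorem gaussImage_eq_image_image (A : Finset M) [DecidableEq (M ⧸ gaussLattice k A)]
    [h : DecidableEq (M ⧸ realSaturation (gaussLattice k A))] :
    gaussImage k A = (A.image (gaussLattice k A).mkQ).image
      (Submodule.factor (le_realSaturation (gaussLattice k A))) := by
  rw [Finset.image_image]
  exact @gaussImage_eq_image _ _ _ _ A h

omit [Module.Free ℤ M] [Module.Finite ℤ M] in
theorem card_gaussImage_le (A : Finset M) [DecidableEq (M ⧸ gaussLattice k A)] :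
    (gaussImage k A).card ≤ (A.image (gaussLattice k A).mkQ).card := by
  classical
  rw [gaussImage_eq_image_image A]
  exact Finset.card_image_le

/-- If `M / ⟨B - B⟩` has no torsion of order the characteristic, then the image of `A` in `M'`
consists of affinely independent points, and has the same fibers as the image
in `M / ⟨B - B⟩`. -/
theorem AffinelyGenerates.card_gaussImage {A : Finset M} (hA : AffinelyGenerates A)
    (hL : ∀ p : ℕ, p.Prime → (p : k) = 0 → ∀ m : M,
      p • m ∈ gaussLattice k A → m ∈ gaussLattice k A) :
    (gaussImage k A).card = Module.finrank ℤ (GaussQuotient k A) + 1 ∧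
      ∀ u ∈ A, ∀ u' ∈ A, u - u' ∈ gaussKernel k A → u - u' ∈ gaussLattice k A := by
  classical
  have h1 : AffinelyGenerates (gaussImage k A) := by
    rw [gaussImage_eq_image]
    exact hA.image (gaussKernel k A).mkQ (Submodule.mkQ_surjective _)
  have h2 := h1.finrank_lt_card
  have h3 := card_gaussImage_le (k := k) A
  have h4 := hA.card_image_le_finrank_gaussAnnihilator (k := k)
  have h5 := finrank_gaussAnnihilator_le hL
  -- The chain rank M' + 1 ≤ #π(A) ≤ #(A mod ⟨B - B⟩) ≤ dim of the annihilator ≤ rank M' + 1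
  -- collapses. The middle equality makes the map between the two images of A injective.
  refine ⟨by omega, fun u hu u' hu' h => ?_⟩
  have h6 := congrArg Finset.card (gaussImage_eq_image_image (k := k) A)
  have h7 := Finset.card_image_iff.1 (h6.symm.trans (show _ = _ by omega))
  rw [← Submodule.Quotient.eq]
  refine h7 (Finset.mem_coe.2 (Finset.mem_image_of_mem _ hu))
    (Finset.mem_coe.2 (Finset.mem_image_of_mem _ hu')) ?_
  exact (Submodule.Quotient.eq _).2 h

end GaussLattice

/-! ### The homogeneous ideal and the tangent spaces of a toric variety -/

section Points

variable {k : Type*} [Field k] {M : Type*} [AddCommGroup M] {A : Finset M}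

variable (k A) in
/-- The homomorphism `x_u ↦ z^(u, 1)` from the homogeneous coordinate ring of the projective space
to the coordinate ring of the torus `T_M × 𝔾ₘ`. -/
def torusHom : MvPolynomial A k →ₐ[k] AddMonoidAlgebra k (M × ℤ) :=
  MvPolynomial.aeval fun u => AddMonoidAlgebra.single ((u : M), (1 : ℤ)) (1 : k)

theorem torusHom_X (u : A) :
    torusHom k A (MvPolynomial.X u) = AddMonoidAlgebra.single ((u : M), (1 : ℤ)) (1 : k) := by
  simp [torusHom]

theorem torusHom_monomial (s : A →₀ ℕ) (r : k) :
    torusHom k A (MvPolynomial.monomial s r) =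
      AddMonoidAlgebra.single (∑ u, s u • ((u : M), (1 : ℤ))) r := by
  rw [torusHom, MvPolynomial.aeval_monomial, Finsupp.prod_fintype _ _ (by simp)]
  simp only [AddMonoidAlgebra.single_pow, one_pow]
  rw [AddMonoidAlgebra.prod_single]
  simp [AddMonoidAlgebra.single_mul_single]

/-- The point of the cone over the torus given by a character of `M × ℤ`. -/
def coneVec (A : Finset M) (χ : Torus k (M × ℤ)) : A → k :=
  fun u => χ (Multiplicative.ofAdd ((u : M), (1 : ℤ)))

theorem lift_torusHom (χ : Torus k (M × ℤ)) (f : MvPolynomial A k) :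
    AddMonoidAlgebra.lift k k (M × ℤ) ((Units.coeHom k).comp χ) (torusHom k A f) =
      MvPolynomial.eval (coneVec A χ) f := by
  have : ((AddMonoidAlgebra.lift k k (M × ℤ) ((Units.coeHom k).comp χ)).comp (torusHom k A)) =
      MvPolynomial.aeval (coneVec A χ) := by
    ext u
    simp [torusHom, coneVec]
  simpa [MvPolynomial.aeval_eq_eval] using DFunLike.congr_fun this f

/-- The character of `M × ℤ` given by a point of the torus and a scalar. -/
def coneChar (t : Torus k M) (c : kˣ) : Torus k (M × ℤ) :=
  (t.comp (AddMonoidHom.toMultiplicative (AddMonoidHom.fst M ℤ))) *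
    ((zpowersHom kˣ c).comp (AddMonoidHom.toMultiplicative (AddMonoidHom.snd M ℤ)))

theorem coneVec_coneChar (t : Torus k M) (c : kˣ) :
    coneVec A (coneChar t c) = fun u => (c : k) * torusVec A t u := by
  funext u
  simp [coneVec, coneChar, torusVec, mul_comm]

theorem coneVec_eq (χ : Torus k (M × ℤ)) :
    ∃ (t : Torus k M) (c : kˣ), coneVec A χ = fun u => (c : k) * torusVec A t u := by
  refine ⟨χ.comp (AddMonoidHom.toMultiplicative (AddMonoidHom.inl M ℤ)),
    χ (Multiplicative.ofAdd (0, 1)), funext fun u => ?_⟩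
  simp only [coneVec, torusVec, MonoidHom.comp_apply, AddMonoidHom.toMultiplicative_apply_apply,
    AddMonoidHom.inl_apply, toAdd_ofAdd]
  rw [← Units.val_mul, ← map_mul, ← ofAdd_add]
  simp

theorem coneVec_ne_zero (χ : Torus k (M × ℤ)) (u : A) : coneVec A χ u ≠ 0 := Units.ne_zero _

section Ideal

theorem eval_rep_eq_zero {ι : Type*} {X : ProjVariety k ι} {x : ℙ k (ι → k)} (hx : x ∈ X.carrier)
    {f : MvPolynomial ι k} (hf : f ∈ X.ideal) : MvPolynomial.eval x.rep f = 0 :=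
  hf x hx x.rep x.rep_nonzero x.mk_rep

theorem exists_coneVec_eq_rep (t : Torus k M) (hA : A.Nonempty) :
    ∃ c : kˣ, coneVec A (coneChar t c) = (torusPoint (k := k) A hA t).rep := by
  obtain ⟨c, hc⟩ := Projectivization.exists_smul_eq_mk_rep k (torusVec A t) (torusVec_ne_zero hA t)
  exact ⟨c, by rw [coneVec_coneChar]; exact hc⟩

variable [Infinite k] [Module.Free ℤ M] [Module.Finite ℤ M]

theorem mem_ideal_toricVariety_iff (hA : A.Nonempty) (f : MvPolynomial A k) :
    f ∈ (toricVariety (k := k) A hA).ideal ↔ torusHom k A f = 0 := by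
  change f ∈ vanishingIdeal (zariskiClosure _) ↔ _
  rw [vanishingIdeal_zariskiClosure, mem_vanishingIdeal_range]
  constructor
  · intro h
    refine eq_zero_of_forall_torus _ fun χ => ?_
    rw [lift_torusHom]
    obtain ⟨t, c, htc⟩ := coneVec_eq (A := A) χ
    rw [htc]
    exact h t c
  · intro h t c
    rw [← coneVec_coneChar, ← lift_torusHom, h, map_zero]

theorem X_notMem_ideal (hA : A.Nonempty) (u : A) :
    MvPolynomial.X u ∉ (toricVariety (k := k) A hA).ideal := by
  rw [mem_ideal_toricVariety_iff, torusHom_X]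
  simp

theorem monomial_sub_mem_ideal (hA : A.Nonempty) {s s' : A →₀ ℕ}
    (h : ∑ u, s u • ((u : M), (1 : ℤ)) = ∑ u, s' u • ((u : M), (1 : ℤ))) :
    MvPolynomial.monomial s 1 - MvPolynomial.monomial s' 1 ∈
      (toricVariety (k := k) A hA).ideal := by
  rw [mem_ideal_toricVariety_iff, map_sub, torusHom_monomial, torusHom_monomial, h, sub_self]

/-- The points of a toric variety without zero coordinates are the points of the torus. -/
theorem AffinelyGenerates.exists_coneVec_eq (hgen : AffinelyGenerates A) (hA : A.Nonempty)
    {v : A → k} (hv : ∀ u, v u ≠ 0)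
    (hX : ∀ f ∈ (toricVariety (k := k) A hA).ideal, MvPolynomial.eval v f = 0) :
    ∃ χ : Torus k (M × ℤ), coneVec A χ = v := by
  -- The binomials in the ideal say that u ↦ v_u respects the affine relations in A, so it extends
  -- to a character of M × ℤ.
  obtain ⟨f, hf⟩ := hgen.exists_hom (fun u => Additive.ofMul (Units.mk0 (v u) (hv u)))
    (fun s s' h => by
      have h1 := hX _ (monomial_sub_mem_ideal hA h)
      rw [map_sub, sub_eq_zero, MvPolynomial.eval_monomial, MvPolynomial.eval_monomial,
        Finsupp.prod_fintype _ _ (by simp), Finsupp.prod_fintype _ _ (by simp), one_mul,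
        one_mul] at h1
      apply Additive.toMul.injective
      rw [toMul_sum, toMul_sum]
      apply Units.ext
      simpa using h1)
  refine ⟨AddMonoidHom.toMultiplicativeLeft f.toAddMonoidHom, funext fun u => ?_⟩
  have := congrArg (fun x => ((Additive.toMul x : kˣ) : k)) (hf u)
  simpa [coneVec] using this

theorem AffinelyGenerates.exists_coneVec_eq_rep (hgen : AffinelyGenerates A) (hA : A.Nonempty)
    {x : ℙ k (A → k)} (hx : x ∈ (toricVariety (k := k) A hA).carrier) (hv : ∀ u, x.rep u ≠ 0) :
    ∃ χ : Torus k (M × ℤ), coneVec A χ = x.rep :=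
  hgen.exists_coneVec_eq hA hv fun _ hf => eval_rep_eq_zero hx hf

theorem torusPoint_mem_carrier (hA : A.Nonempty) (t : Torus k M) :
    torusPoint A hA t ∈ (toricVariety (k := k) A hA).carrier :=
  subset_zariskiClosure _ ⟨t, rfl⟩

end Ideal

section Tangent

theorem sum_eval_pderiv_monomial {ι : Type*} [Fintype ι] (v y : ι → k) (s : ι →₀ ℕ) (r : k) :
    ∑ u, MvPolynomial.eval v (MvPolynomial.pderiv u (MvPolynomial.monomial s r)) * (v u * y u) =
      MvPolynomial.eval v (MvPolynomial.monomial s r) * ∑ u, s u • y u := by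
  rw [Finset.mul_sum]
  refine Finset.sum_congr rfl fun u _ => ?_
  have h := congrArg (MvPolynomial.eval v)
    (MvPolynomial.X_mul_pderiv_monomial (i := u) (m := s) (r := r))
  rw [map_mul, MvPolynomial.eval_X, map_nsmul, nsmul_eq_mul] at h
  rw [nsmul_eq_mul]
  linear_combination y u * h

/-- The tangent vectors at a point `v` of the torus: `a ↦ (v_u a(u))`. -/
def tangentParam (v : A → k) : AffFun k M →ₗ[k] (A → k) :=
  LinearMap.pi fun u => v u • affEval (u : M)

theorem tangentParam_apply (v : A → k) (a : AffFun k M) (u : A) :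
    tangentParam v a u = v u * affEval (u : M) a := rfl

theorem AffinelyGenerates.tangentParam_injective (hgen : AffinelyGenerates A) {v : A → k}
    (hv : ∀ u, v u ≠ 0) : Function.Injective (tangentParam v) := by
  rw [injective_iff_map_eq_zero]
  intro a ha
  refine hgen.ext fun u hu => ?_
  have := congrFun ha ⟨u, hu⟩
  rw [tangentParam_apply] at this
  exact (mul_eq_zero.1 this).resolve_left (hv _)

/-- An affine function a induces the invariant derivation z^m ↦ a(m) z^m of the torus. The
derivative of f in this direction therefore depends only on the image of f in the coordinate ring of
the torus, and vanishes for f in the ideal. -/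
theorem sum_eval_pderiv_coneVec (χ : Torus k (M × ℤ)) (a : AffFun k M) (f : MvPolynomial A k) :
    ∑ u, MvPolynomial.eval (coneVec A χ) (MvPolynomial.pderiv u f) *
        tangentParam (coneVec A χ) a u =
      Finsupp.linearCombination k
        (fun m => (χ (Multiplicative.ofAdd m) : k) * a.toHom m) (torusHom k A f).coeff := by
  induction f using MvPolynomial.induction_on' with
  | add p q hp hq =>
    simp only [map_add, add_mul, Finset.sum_add_distrib, hp, hq, AddMonoidAlgebra.coeff_add]
  | monomial s r =>
    simp only [tangentParam_apply]
    rw [sum_eval_pderiv_monomial (y := fun u : A => affEval (u : M) a), ← lift_torusHom,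
      torusHom_monomial, AddMonoidAlgebra.lift_single, AddMonoidAlgebra.coeff_single,
      Finsupp.linearCombination_single, map_sum a.toHom]
    simp only [map_nsmul, AffFun.toHom_apply]
    simp [mul_assoc]

variable [Infinite k] [Module.Free ℤ M] [Module.Finite ℤ M]

/-- The differentials of the binomials force w_u / x_u to respect the affine relations in A, hence
to be an affine function of u. The converse is `sum_eval_pderiv_coneVec`. -/
theorem AffinelyGenerates.tangentSpace_eq_range (hgen : AffinelyGenerates A) (hA : A.Nonempty)
    {x : ℙ k (A → k)} {χ : Torus k (M × ℤ)} (hχ : coneVec A χ = x.rep) :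
    (toricVariety (k := k) A hA).tangentSpace x = LinearMap.range (tangentParam x.rep) := by
  refine le_antisymm (fun w hw => ?_) ?_
  · have hv : ∀ u, x.rep u ≠ 0 := fun u => hχ ▸ coneVec_ne_zero χ u
    obtain ⟨a, ha⟩ := hgen.exists_affFun (fun u => w u / x.rep u) (fun s s' h => by
      have h1 := hw _ (monomial_sub_mem_ideal hA h)
      have hw' : w = fun u => x.rep u * (w u / x.rep u) := funext fun u => by
        rw [mul_div_cancel₀ _ (hv u)]
      have h2 : MvPolynomial.eval x.rep (MvPolynomial.monomial s (1 : k)) =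
          MvPolynomial.eval x.rep (MvPolynomial.monomial s' (1 : k)) := by
        rw [← sub_eq_zero, ← map_sub, ← hχ, ← lift_torusHom,
          (mem_ideal_toricVariety_iff hA _).1 (monomial_sub_mem_ideal hA h), map_zero]
      have h3 : MvPolynomial.eval x.rep (MvPolynomial.monomial s' (1 : k)) ≠ 0 := by
        rw [MvPolynomial.eval_monomial, one_mul, Finsupp.prod_fintype _ _ (by simp)]
        exact Finset.prod_ne_zero_iff.2 fun u _ => pow_ne_zero _ (hv u)
      rw [hw'] at h1
      simp only [map_sub, sub_mul, Finset.sum_sub_distrib] at h1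
      rw [sum_eval_pderiv_monomial (y := fun u => w u / x.rep u),
        sum_eval_pderiv_monomial (y := fun u => w u / x.rep u), h2, ← mul_sub] at h1
      exact sub_eq_zero.1 ((mul_eq_zero.1 h1).resolve_left h3))
    refine ⟨a, funext fun u => ?_⟩
    rw [tangentParam_apply, ha, mul_div_cancel₀ _ (hv u)]
  · rintro _ ⟨a, rfl⟩ f hf
    rw [← hχ, sum_eval_pderiv_coneVec, (mem_ideal_toricVariety_iff hA f).1 hf]
    simp

end Tangent

end Points

/-! ### Purely inseparable elements of separably generated extensions -/

/-- Over F(s) the element α is both separable and purely inseparable, so α lies in F(s). There a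
p-th root of a constant is constant, because the polynomial ring over F is integrally closed and its
units are constants. -/
theorem mem_range_algebraMap_of_pow_mem {F E : Type*} [Field F] [Field E] [Algebra F E]
    (h : IsSeparableExtension F E) {p : ℕ} (hp : p.Prime) (hp0 : (p : F) = 0) {α : E}
    (hα : α ^ p ∈ (algebraMap F E).range) : α ∈ (algebraMap F E).range := by
  obtain ⟨s, hs, hsep⟩ := h
  have hα' : α ∈ IntermediateField.adjoin F s := by
    have hchar : CharP (IntermediateField.adjoin F s) p := by
      rw [CharP.charP_iff_prime_eq_zero hp, ← map_natCast (algebraMap F _), hp0, map_zero]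
    have : Fact p.Prime := ⟨hp⟩
    have h1 : α ∈ perfectClosure (IntermediateField.adjoin F s) E := by
      rw [mem_perfectClosure_iff_pow_mem p]
      obtain ⟨a, ha⟩ := hα
      exact ⟨1, algebraMap F _ a, by rw [pow_one, ← ha]; rfl⟩
    rw [perfectClosure.eq_bot_of_isSeparable, IntermediateField.mem_bot] at h1
    obtain ⟨β, rfl⟩ := h1
    exact β.2
  obtain ⟨a, ha⟩ := hα
  obtain ⟨r, hr, t, ht, rfl⟩ := IntermediateField.mem_adjoin_iff_div.1 hα'
  have hrange : Algebra.adjoin F s = (MvPolynomial.aeval ((↑) : s → E) :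
      MvPolynomial s F →ₐ[F] E).range := by
    rw [← Algebra.adjoin_range_eq_range_aeval, Subtype.range_coe]
  rw [hrange] at hr ht
  obtain ⟨R, rfl⟩ := hr
  obtain ⟨T, rfl⟩ := ht
  have hinj := algebraicIndependent_iff_injective_aeval.1 hs.1
  set ev := (MvPolynomial.aeval ((↑) : s → E) : MvPolynomial s F →ₐ[F] E) with hev
  by_cases hT : T = 0
  · exact ⟨0, by simp [hT]⟩
  have hT' : ev T ≠ 0 := fun h0 => hT (hinj (by rw [h0, map_zero]))
  have h2 : R ^ p = MvPolynomial.C a * T ^ p := by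
    apply hinj
    change ev.toRingHom _ = ev.toRingHom _
    simp only [AlgHom.toRingHom_eq_coe, RingHom.coe_coe, map_pow, map_mul]
    have : ev (MvPolynomial.C a) = algebraMap F E a := by rw [hev, MvPolynomial.aeval_C]
    have h3 : (ev R / ev T) ^ p = algebraMap F E a := ha.symm
    rw [this, ← h3, div_pow, div_mul_cancel₀ _ (pow_ne_zero _ hT')]
  obtain ⟨Q, hQ⟩ : T ∣ R := by
    rw [← IsIntegrallyClosed.pow_dvd_pow_iff hp.ne_zero, h2]
    exact dvd_mul_left _ _
  have h3 : Q ^ p = MvPolynomial.C a := by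
    rw [hQ, mul_pow, mul_comm] at h2
    exact mul_right_cancel₀ (pow_ne_zero _ hT) h2
  have h4 : ∃ q, Q = MvPolynomial.C q := by
    by_cases ha0 : a = 0
    · rw [ha0, map_zero] at h3
      exact ⟨0, by rw [map_zero]; exact eq_zero_of_pow_eq_zero h3⟩
    · have h5 : IsUnit Q := by
        rw [← isUnit_pow_iff hp.ne_zero, h3]
        exact (isUnit_iff_ne_zero.2 ha0).map _
      obtain ⟨q, -, hq⟩ := MvPolynomial.isUnit_iff_eq_C_of_isReduced.1 h5
      exact ⟨q, hq⟩
  obtain ⟨q, rfl⟩ := h4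
  refine ⟨q, ?_⟩
  change algebraMap F E q = ev R / ev T
  rw [hQ, map_mul, mul_div_cancel_left₀ _ hT', hev, MvPolynomial.aeval_C]

/-! ### Forms and quotients of forms -/

theorem aeval_mul_of_isHomogeneous {k K κ : Type*} [Field k] [Field K] [Algebra k K]
    {f : MvPolynomial κ k} {d : ℕ} (hf : f.IsHomogeneous d) (h : K) (y : κ → K) :
    MvPolynomial.aeval (fun i => h * y i) f = h ^ d * MvPolynomial.aeval y f := by
  rw [MvPolynomial.aeval_def, MvPolynomial.aeval_def, MvPolynomial.eval₂_eq, MvPolynomial.eval₂_eq,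
    Finset.mul_sum]
  refine Finset.sum_congr rfl fun s hs => ?_
  simp only [mul_pow, Finset.prod_mul_distrib, Finset.prod_pow_eq_pow_sum]
  rw [hf.degree_eq_sum_deg_support hs]
  ring

/-- By homogeneity the common factor h^d cancels, so only the ratios y matter. -/
theorem aeval_div_aeval_mem {k K κ : Type*} [Field k] [Field K] [Algebra k K]
    (F : IntermediateField k K) {x y : κ → K} {h : K} (hxy : ∀ i, x i = h * y i)
    (hy : ∀ i, y i ∈ F) {f g : MvPolynomial κ k} {d : ℕ} (hf : f.IsHomogeneous d)
    (hg : g.IsHomogeneous d) : MvPolynomial.aeval x f / MvPolynomial.aeval x g ∈ F := by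
  obtain rfl : x = fun i => h * y i := funext hxy
  rw [aeval_mul_of_isHomogeneous hf, aeval_mul_of_isHomogeneous hg]
  have hmem : ∀ f : MvPolynomial κ k, MvPolynomial.aeval y f ∈ F := by
    intro f
    have : MvPolynomial.aeval y f = F.val (MvPolynomial.aeval (fun i => (⟨y i, hy i⟩ : F)) f) := by
      rw [← AlgHom.comp_apply, MvPolynomial.comp_aeval]
      rfl
    rw [this]
    exact Subtype.prop _
  by_cases h0 : h ^ d = 0
  · simp [h0]
  · rw [mul_div_mul_left _ _ h0]
    exact div_mem (hmem f) (hmem g)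

/-! ### The function field of a toric variety -/

section FunctionField

variable {k : Type*} [Field k] {M : Type*} [AddCommGroup M] {A : Finset M}

variable (k M) in
/-- The function field of the torus `T_M × 𝔾ₘ`. -/
abbrev TorusField : Type _ := FractionRing (AddMonoidAlgebra k (M × ℤ))

variable (k) in
/-- The monomials `z^m` in the function field of the torus. -/
def zMon (m : M × ℤ) : TorusField k M :=
  algebraMap (AddMonoidAlgebra k (M × ℤ)) _ (AddMonoidAlgebra.single m 1)

theorem zMon_zero : zMon k (0 : M × ℤ) = 1 := by
  rw [zMon, ← AddMonoidAlgebra.one_def, map_one]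

theorem zMon_add (m m' : M × ℤ) : zMon k (m + m') = zMon k m * zMon k m' := by
  rw [zMon, zMon, zMon, ← map_mul, AddMonoidAlgebra.single_mul_single, one_mul]

theorem zMon_ne_zero (m : M × ℤ) : zMon k m ≠ 0 := by
  intro h
  have := IsFractionRing.injective (AddMonoidAlgebra k (M × ℤ)) (TorusField k M)
    (h.trans (map_zero _).symm)
  simp at this

theorem zMon_nsmul (n : ℕ) (m : M × ℤ) : zMon k (n • m) = zMon k m ^ n := by
  rw [zMon, zMon, ← map_pow, AddMonoidAlgebra.single_pow, one_pow]

variable (k A) in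
/-- The homomorphism `x_u ↦ z^(u, 1)` to the function field of the torus. -/
def torusFieldHom : MvPolynomial A k →ₐ[k] TorusField k M :=
  ((Algebra.ofId (AddMonoidAlgebra k (M × ℤ)) (TorusField k M)).restrictScalars k).comp
    (torusHom k A)

theorem torusFieldHom_apply (f : MvPolynomial A k) :
    torusFieldHom k A f = algebraMap _ (TorusField k M) (torusHom k A f) := rfl

theorem torusFieldHom_X (u : A) :
    torusFieldHom k A (MvPolynomial.X u) = zMon k ((u : M), (1 : ℤ)) := by
  rw [torusFieldHom_apply, torusHom_X, zMon]

variable [Module.Free ℤ M] [Module.Finite ℤ M]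

instance isDomain_addMonoidAlgebra_prod_int : IsDomain (AddMonoidAlgebra k (M × ℤ)) := by
  have : AddGroup.FG (M × ℤ) := Module.Finite.iff_addGroup_fg.1 inferInstance
  have : AddMonoid.FG (M × ℤ) := inferInstance
  have : IsAddTorsionFree (M × ℤ) := .of_isTorsionFree ℤ _
  exact NoZeroDivisors.to_isDomain _

theorem zMon_neg (m : M × ℤ) : zMon k (-m) = (zMon k m)⁻¹ := by
  rw [← mul_eq_one_iff_eq_inv₀ (zMon_ne_zero m), ← zMon_add, neg_add_cancel, zMon_zero]

theorem zMon_sub (m m' : M × ℤ) : zMon k (m - m') = zMon k m / zMon k m' := by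
  rw [sub_eq_add_neg, zMon_add, zMon_neg, div_eq_mul_inv]

/-- The exponents of the monomials of degree `0` which lie in a subfield. -/
def exponents (F : IntermediateField k (TorusField k M)) : Submodule ℤ M :=
  AddSubgroup.toIntSubmodule
    { carrier := {m | zMon k (m, (0 : ℤ)) ∈ F}
      add_mem' := by
        intro m m' h h'
        have h1 : ((m + m', 0) : M × ℤ) = (m, 0) + (m', 0) := by simp
        change zMon k (m + m', (0 : ℤ)) ∈ F
        rw [h1, zMon_add]
        exact mul_mem h h'
      zero_mem' := by
        change zMon k (0 : M × ℤ) ∈ F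
        rw [zMon_zero]
        exact one_mem F
      neg_mem' := by
        intro m h
        have h1 : ((-m, 0) : M × ℤ) = -(m, 0) := by simp
        change zMon k (-m, (0 : ℤ)) ∈ F
        rw [h1, zMon_neg]
        exact inv_mem h }

theorem mem_exponents {F : IntermediateField k (TorusField k M)} {m : M} :
    m ∈ exponents F ↔ zMon k (m, (0 : ℤ)) ∈ F := Iff.rfl

variable (k) in
/-- The subfield generated by the monomials with exponents in a sublattice. -/
def monomialField (L : Submodule ℤ M) : IntermediateField k (TorusField k M) :=
  IntermediateField.adjoin k ((fun m : M => zMon k (m, (0 : ℤ))) '' (L : Set M))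

/-- Write z^m = x / y with x and y Laurent polynomials supported over L. Then z^m y = x, so m is the
difference of an exponent of x and one of y. -/
theorem exponents_monomialField (L : Submodule ℤ M) : exponents (monomialField k L) = L := by
  refine le_antisymm (fun m hm => ?_)
    fun m hm => IntermediateField.subset_adjoin _ _ ⟨m, hm, rfl⟩
  have key : ∀ r ∈ Algebra.adjoin k ((fun m : M => zMon k (m, (0 : ℤ))) '' (L : Set M)),
      ∃ x : AddMonoidAlgebra k (M × ℤ), algebraMap _ (TorusField k M) x = r ∧
        ∀ m, x.coeff m ≠ 0 → m.1 ∈ L := by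
    intro r hr
    induction hr using Algebra.adjoin_induction with
    | mem r hr =>
      obtain ⟨l, hl, rfl⟩ := hr
      refine ⟨_, rfl, fun m hm => ?_⟩
      classical
      rw [AddMonoidAlgebra.coeff_single, Finsupp.single_apply] at hm
      obtain rfl : (l, (0 : ℤ)) = m := by
        by_contra h
        simp [h] at hm
      exact hl
    | algebraMap c =>
      refine ⟨algebraMap k _ c, (IsScalarTower.algebraMap_apply _ _ _ _).symm, fun m hm => ?_⟩
      have h1 : algebraMap k (AddMonoidAlgebra k (M × ℤ)) c = AddMonoidAlgebra.single 0 c := by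
        simp
      classical
      rw [h1, AddMonoidAlgebra.coeff_single, Finsupp.single_apply] at hm
      obtain rfl : (0 : M × ℤ) = m := by
        by_contra h
        simp [h] at hm
      exact L.zero_mem
    | add r r' _ _ h h' =>
      obtain ⟨x, rfl, hx⟩ := h
      obtain ⟨x', rfl, hx'⟩ := h'
      refine ⟨x + x', map_add _ _ _, fun m hm => ?_⟩
      by_cases h0 : x.coeff m = 0
      · refine hx' m fun h1 => hm ?_
        simp [h0, h1]
      · exact hx m h0
    | mul r r' _ _ h h' =>
      obtain ⟨x, rfl, hx⟩ := h
      obtain ⟨x', rfl, hx'⟩ := h'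
      refine ⟨x * x', map_mul _ _ _, fun m hm => ?_⟩
      rw [AddMonoidAlgebra.coeff_mul_apply_left] at hm
      obtain ⟨l, hl, hne⟩ := Finset.exists_ne_zero_of_sum_ne_zero hm
      have h1 := hx l (left_ne_zero_of_mul hne)
      have h2 := hx' _ (right_ne_zero_of_mul hne)
      have h3 := L.add_mem h1 h2
      simpa using h3
  obtain ⟨r, hr, s, hs, hrs⟩ := IntermediateField.mem_adjoin_iff_div.1 (mem_exponents.1 hm)
  obtain ⟨x, rfl, hx⟩ := key r hr
  obtain ⟨y, rfl, hy⟩ := key s hs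
  have hy0 : algebraMap _ (TorusField k M) y ≠ 0 := by
    intro h0
    rw [h0, div_zero] at hrs
    exact zMon_ne_zero _ hrs
  rw [eq_div_iff hy0, zMon, ← map_mul] at hrs
  have h1 := IsFractionRing.injective (AddMonoidAlgebra k (M × ℤ)) (TorusField k M) hrs
  obtain ⟨l, hl⟩ : ∃ l, y.coeff l ≠ 0 := by
    by_contra! h
    exact hy0 (by rw [show y = 0 from AddMonoidAlgebra.coeff_injective (Finsupp.ext h), map_zero])
  have h2 : x.coeff ((m, 0) + l) ≠ 0 := by
    rw [← h1, AddMonoidAlgebra.coeff_single_mul_apply]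
    rwa [one_mul, neg_add_cancel_left]
  have h3 := L.sub_mem (hx _ h2) (hy _ hl)
  simpa using h3

variable [Infinite k]

theorem torusFieldHom_eq_zero_iff (hA : A.Nonempty) (f : MvPolynomial A k) :
    torusFieldHom k A f = 0 ↔ f ∈ (toricVariety (k := k) A hA).ideal := by
  rw [mem_ideal_toricVariety_iff, torusFieldHom_apply]
  exact map_eq_zero_iff _ (IsFractionRing.injective _ _)

theorem liftₐ_torusFieldHom_injective (hA : A.Nonempty) :
    Function.Injective (Ideal.Quotient.liftₐ (toricVariety (k := k) A hA).ideal
      (torusFieldHom k A) fun f hf => (torusFieldHom_eq_zero_iff hA f).2 hf) := by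
  rw [injective_iff_map_eq_zero]
  intro f hf
  obtain ⟨f, rfl⟩ := Ideal.Quotient.mk_surjective f
  exact Ideal.Quotient.eq_zero_iff_mem.2 ((torusFieldHom_eq_zero_iff hA f).1 hf)

/-- The embedding of the fraction field of the homogeneous coordinate ring of the toric variety
into the function field of the torus. -/
def coneEmb (hA : A.Nonempty) : (toricVariety (k := k) A hA).ConeField →ₐ[k] TorusField k M :=
  IsFractionRing.liftAlgHom (liftₐ_torusFieldHom_injective hA)

theorem coneEmb_mk (hA : A.Nonempty) (f : MvPolynomial A k) :
    coneEmb hA (algebraMap _ _ (Ideal.Quotient.mk (toricVariety (k := k) A hA).ideal f)) =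
      torusFieldHom k A f := by
  rw [coneEmb, IsFractionRing.liftAlgHom_apply]
  exact IsFractionRing.lift_algebraMap (liftₐ_torusFieldHom_injective hA) _

theorem coneEmb_frac (hA : A.Nonempty) (f g : MvPolynomial A k) :
    coneEmb hA ((toricVariety (k := k) A hA).frac f g) =
      torusFieldHom k A f / torusFieldHom k A g := by
  rw [ProjVariety.frac, map_div₀, coneEmb_mk, coneEmb_mk]

theorem map_coneEmb_functionField_le (hA : A.Nonempty) {F : IntermediateField k (TorusField k M)}
    (hF : exponents F = ⊤) :
    (toricVariety (k := k) A hA).functionField.map (coneEmb hA) ≤ F := by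
  rw [ProjVariety.functionField, IntermediateField.adjoin_map, IntermediateField.adjoin_le_iff]
  rintro _ ⟨_, ⟨d, f, g, hf, hg, -, rfl⟩, rfl⟩
  obtain ⟨u₀, hu₀⟩ := id hA
  have h1 : torusFieldHom k A = MvPolynomial.aeval fun u : A => zMon k ((u : M), (1 : ℤ)) := by
    ext u
    simp [torusFieldHom_X]
  rw [SetLike.mem_coe, coneEmb_frac, h1]
  -- Dividing all coordinates by the one at u₀ leaves monomials of degree 0, which lie in F.
  refine aeval_div_aeval_mem F (h := zMon k (u₀, (1 : ℤ)))
    (y := fun u : A => zMon k ((u : M) - u₀, (0 : ℤ))) (fun u => ?_) (fun u => ?_) hf hg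
  · rw [← zMon_add]
    simp
  · rw [← mem_exponents, hF]
    trivial

theorem AffinelyGenerates.exponents_functionField (hgen : AffinelyGenerates A) (hA : A.Nonempty) :
    exponents ((toricVariety (k := k) A hA).functionField.map (coneEmb hA)) = ⊤ := by
  obtain ⟨u₀, hu₀⟩ := id hA
  refine eq_top_iff.2 fun m _ => hgen.mem_of_forall_sub_mem _ u₀ (fun u hu => ?_) m
  rw [mem_exponents]
  refine ⟨_, IntermediateField.subset_adjoin k _ ⟨1, MvPolynomial.X ⟨u, hu⟩,
    MvPolynomial.X ⟨u₀, hu₀⟩, MvPolynomial.isHomogeneous_X _ _, MvPolynomial.isHomogeneous_X _ _,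
    X_notMem_ideal hA _, rfl⟩, ?_⟩
  change coneEmb hA _ = _
  rw [coneEmb_frac, torusFieldHom_X, torusFieldHom_X, ← zMon_sub]
  simp

end FunctionField

/-! ### Dimension and smoothness of toric varieties along the torus -/

section Dimension

variable {k : Type*} [Field k] {M : Type*} [AddCommGroup M] {A : Finset M}

-- Polynomials in these monomials form the monoid algebra of ℕ^ι, and the exponent map from ℕ^ι to M
-- × ℤ is injective because b is a basis.
variable (k) in
theorem algebraicIndependent_zMon {ι : Type*} (b : Module.Basis ι ℤ M) :
    AlgebraicIndependent k fun i => zMon k (b i, (0 : ℤ)) := by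
  let e : (ι →₀ ℕ) →+ M × ℤ :=
    { toFun := fun s => (b.repr.symm (s.mapRange (Nat.castAddMonoidHom ℤ) (map_zero _)), 0)
      map_zero' := by simp
      map_add' := fun s s' => by
        rw [Finsupp.mapRange_add (map_add _), map_add]
        simp }
  have he : Function.Injective e := by
    intro s s' h
    have h1 := b.repr.symm.injective (congrArg Prod.fst h)
    exact Finsupp.mapRange_injective _ _ Nat.cast_injective h1
  have h1 : Function.Injective (AddMonoidAlgebra.mapDomainAlgHom k k e) :=
    AddMonoidAlgebra.mapDomain_injective he
  have h2 : ∀ f : MvPolynomial ι k, MvPolynomial.aeval (fun i => zMon k (b i, (0 : ℤ))) f =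
      algebraMap _ (TorusField k M) (AddMonoidAlgebra.mapDomainAlgHom k k e f) := by
    intro f
    let Ψ : MvPolynomial ι k →ₐ[k] TorusField k M :=
      ((Algebra.ofId (AddMonoidAlgebra k (M × ℤ)) (TorusField k M)).restrictScalars k).comp
        (AddMonoidAlgebra.mapDomainAlgHom k k e)
    have h3 : MvPolynomial.aeval (fun i => zMon k (b i, (0 : ℤ))) = Ψ := by
      ext i
      rw [MvPolynomial.aeval_X]
      change _ = algebraMap _ (TorusField k M) (AddMonoidAlgebra.mapDomainAlgHom k k e
        (AddMonoidAlgebra.single (Finsupp.single i 1) 1))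
      rw [zMon]
      congr 1
      simp [e]
    exact DFunLike.congr_fun h3 f
  rw [algebraicIndependent_iff_injective_aeval]
  intro f g hfg
  simp only [h2] at hfg
  exact h1 (IsFractionRing.injective _ _ hfg)

variable [Module.Free ℤ M] [Module.Finite ℤ M] [Infinite k]

/-- The monomials of a basis of M lie in the function field and generate it, so they form a
transcendence basis. -/
theorem AffinelyGenerates.dim_toricVariety (hgen : AffinelyGenerates A) (hA : A.Nonempty) :
    (toricVariety (k := k) A hA).dim = Module.finrank ℤ M := by
  set E := (toricVariety (k := k) A hA).functionField with hE
  let b := Module.Free.chooseBasis ℤ M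
  let ψ : E →ₐ[k] TorusField k M := (coneEmb hA).comp E.val
  have hψ : Function.Injective ψ := ψ.injective
  have hx : ∀ m : M, ∃ x : E, ψ x = zMon k (m, (0 : ℤ)) := by
    intro m
    have h1 : m ∈ exponents (E.map (coneEmb hA)) := by
      rw [hE, hgen.exponents_functionField hA]
      trivial
    obtain ⟨x, hx, hxm⟩ := h1
    exact ⟨⟨x, hx⟩, hxm⟩
  choose x hx using hx
  have hind : AlgebraicIndependent k fun i => x (b i) := by
    refine AlgebraicIndependent.of_comp ψ ?_
    have : ψ ∘ (fun i => x (b i)) = fun i => zMon k (b i, (0 : ℤ)) := funext fun i => hx _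
    rw [this]
    exact algebraicIndependent_zMon k b
  have hfield : IntermediateField.adjoin k (Set.range fun i => ψ (x (b i))) ≥
      E.map (coneEmb hA) := by
    refine map_coneEmb_functionField_le hA (eq_top_iff.2 ?_)
    rw [← b.span_eq, Submodule.span_le]
    rintro _ ⟨i, rfl⟩
    rw [SetLike.mem_coe, mem_exponents, ← hx]
    exact IntermediateField.subset_adjoin _ _ ⟨i, rfl⟩
  have htb : IsTranscendenceBasis k fun i => x (b i) := by
    rw [hind.isTranscendenceBasis_iff_isAlgebraic]
    refine ⟨fun α => ?_⟩
    have hα : ψ α ∈ E.map (coneEmb hA) := ⟨α, α.2, rfl⟩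
    obtain ⟨r, hr, s, hs, hrs⟩ := IntermediateField.mem_adjoin_iff_div.1 (hfield hα)
    have himg : Algebra.adjoin k (Set.range fun i => ψ (x (b i))) =
        (Algebra.adjoin k (Set.range fun i => x (b i))).map ψ := by
      rw [AlgHom.map_adjoin, ← Set.range_comp]
      rfl
    rw [himg] at hr hs
    obtain ⟨r, hr, rfl⟩ := hr
    obtain ⟨s, hs, rfl⟩ := hs
    have h1 : α = r * s⁻¹ := hψ (by
      rw [map_mul, map_inv₀, hrs, div_eq_mul_inv]
      rfl)
    rw [h1]
    exact (isAlgebraic_algebraMap (⟨r, hr⟩ : Algebra.adjoin k (Set.range fun i => x (b i)))).mul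
      (isAlgebraic_algebraMap (⟨s, hs⟩ : Algebra.adjoin k (Set.range fun i => x (b i)))).inv
  have h2 := congrArg Cardinal.toNat htb.lift_cardinalMk_eq_trdeg
  rw [Cardinal.toNat_lift, Cardinal.toNat_lift] at h2
  rw [ProjVariety.dim, ← h2, Module.finrank_eq_card_chooseBasisIndex, Cardinal.mk_fintype,
    Cardinal.toNat_natCast]

theorem AffinelyGenerates.isSmoothAt (hgen : AffinelyGenerates A) (hA : A.Nonempty)
    {x : ℙ k (A → k)} (hx : x ∈ (toricVariety (k := k) A hA).carrier) {χ : Torus k (M × ℤ)}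
    (hχ : coneVec A χ = x.rep) : (toricVariety (k := k) A hA).IsSmoothAt x := by
  refine ⟨hx, ?_⟩
  rw [hgen.tangentSpace_eq_range hA hχ, LinearMap.finrank_range_of_inj
    (hgen.tangentParam_injective fun u => hχ ▸ coneVec_ne_zero χ u), finrank_affFun,
    hgen.dim_toricVariety hA]

end Dimension

/-! ### Plücker vectors -/

/-- The scalar is the determinant of the change of basis. -/
theorem IsPluckerVector.exists_eq_smul {k : Type*} [Field k] {ι : Type*} {m : ℕ}
    {W : Submodule k (ι → k)} {p q : (Fin m → ι) → k} (hp : IsPluckerVector W p)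
    (hq : IsPluckerVector W q) : ∃ c : k, c ≠ 0 ∧ p = c • q := by
  obtain ⟨w, hw, hwW, rfl⟩ := hp
  obtain ⟨w', hw', hwW', rfl⟩ := hq
  let b := (Module.Basis.span hw).map (LinearEquiv.ofEq _ _ hwW)
  let b' := (Module.Basis.span hw').map (LinearEquiv.ofEq _ _ hwW')
  have hb : ∀ i, (b i : ι → k) = w i := fun i => by
    simp [b, Module.Basis.span_apply]
  have hb' : ∀ i, (b' i : ι → k) = w' i := fun i => by
    simp [b', Module.Basis.span_apply]
  refine ⟨(b'.toMatrix b).det, ?_, funext fun I => ?_⟩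
  · have h1 : (b'.toMatrix b) * (b.toMatrix b') = 1 := b'.toMatrix_mul_toMatrix_flip b
    intro h0
    have h2 := congrArg Matrix.det h1
    rw [Matrix.det_mul, h0, zero_mul, Matrix.det_one] at h2
    exact zero_ne_one h2
  · rw [Pi.smul_apply, smul_eq_mul, ← Matrix.det_transpose (b'.toMatrix b), ← Matrix.det_mul]
    congr 1
    ext i j
    rw [Matrix.of_apply, Matrix.mul_apply]
    have h1 := congrArg (fun x : W => (x : ι → k) (I j)) (b'.sum_toMatrix_smul_self b i)
    simp only [AddSubmonoidClass.coe_finsetSum, SetLike.val_smul, Finset.sum_apply, Pi.smul_apply,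
      hb, hb', smul_eq_mul] at h1
    rw [← h1]
    rfl

theorem mem_vanishingIdeal_of_eval_rep {k : Type*} [Field k] {ι : Type*}
    {S : Set (ℙ k (ι → k))} {f : MvPolynomial ι k} {d : ℕ} (hf : f.IsHomogeneous d)
    (h : ∀ x ∈ S, MvPolynomial.eval x.rep f = 0) : f ∈ vanishingIdeal S := by
  rintro x hx v hv rfl
  obtain ⟨c, hc⟩ := Projectivization.exists_smul_eq_mk_rep k v hv
  have h1 := h _ hx
  rw [← hc] at h1
  have h2 := aeval_mul_of_isHomogeneous hf (c : k) v
  rw [MvPolynomial.aeval_eq_eval, MvPolynomial.aeval_eq_eval] at h2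
  change MvPolynomial.eval (fun i => (c : k) * v i) f = (c : k) ^ d * MvPolynomial.eval v f at h2
  have h3 : (c : k) ^ d * MvPolynomial.eval v f = 0 := h2.symm.trans h1
  exact (mul_eq_zero.1 h3).resolve_left (pow_ne_zero _ c.ne_zero)

theorem sum_sum_single_smul {ι : Type*} [Fintype ι] {N : ℕ} {N' : Type*} [AddCommMonoid N']
    (I : Fin N → ι) (y : ι → N') :
    ∑ u, (∑ b, Finsupp.single (I b) 1 : ι →₀ ℕ) u • y u = ∑ b, y (I b) := by
  classical
  simp only [Finsupp.finsetSum_apply, Finset.sum_smul]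
  rw [Finset.sum_comm]
  refine Finset.sum_congr rfl fun b _ => ?_
  rw [Finset.sum_eq_single (I b)]
  · simp
  · intro u _ hu
    simp [hu]
  · simp

theorem isHomogeneous_prod_X {k : Type*} [Field k] {ι : Type*} [Fintype ι] :
    (∏ u : ι, (MvPolynomial.X u : MvPolynomial ι k)).IsHomogeneous (Fintype.card ι) := by
  have := MvPolynomial.IsHomogeneous.prod Finset.univ
    (fun u : ι => (MvPolynomial.X u : MvPolynomial ι k)) (fun _ => 1)
    fun u _ => MvPolynomial.isHomogeneous_X k u
  simpa using this

/-! ### Monomial Plücker coordinates of the tangent spaces -/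

section GaussForm

variable {k : Type*} [Field k] {M : Type*} [AddCommGroup M] {A : Finset M} {N : ℕ}

/-- The minors of the matrix of the values of a basis of the space of affine functions. -/
def gaussDet (c : Module.Basis (Fin N) k (AffFun k M)) (I : Fin N → A) : k :=
  (Matrix.of fun a b => affEval (I b : M) (c a)).det

/-- A vector in the left kernel of the matrix is the coordinate vector of an affine function
vanishing on the tuple. -/
theorem gaussDet_ne_zero_iff (c : Module.Basis (Fin N) k (AffFun k M)) (I : Fin N → A) :
    gaussDet c I ≠ 0 ↔ IsSpanningTuple k fun b => (I b : M) := by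
  have key : ∀ (v : Fin N → k) (b : Fin N),
      Matrix.vecMul v (Matrix.of fun a b => affEval (I b : M) (c a)) b =
        affEval (I b : M) (c.equivFun.symm v) := by
    intro v b
    simp [Matrix.vecMul, dotProduct, Module.Basis.equivFun_symm_apply]
  rw [gaussDet, Ne, ← Matrix.exists_vecMul_eq_zero_iff]
  constructor
  · intro h a ha
    by_contra hne
    refine h ⟨c.equivFun a, fun h0 => hne (c.equivFun.map_eq_zero_iff.1 h0), funext fun b => ?_⟩
    rw [key, LinearEquiv.symm_apply_apply]
    exact ha b
  · rintro h ⟨v, hv, h0⟩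
    refine hv (c.equivFun.symm.map_eq_zero_iff.1 (h _ fun b => ?_))
    rw [← key, h0]
    rfl

/-- The forms defining the Gauss map of a toric variety. -/
def gaussForm (c : Module.Basis (Fin N) k (AffFun k M)) (I : Fin N → A) : MvPolynomial A k :=
  MvPolynomial.monomial (∑ b, Finsupp.single (I b) 1) (gaussDet c I)

theorem isHomogeneous_gaussForm (c : Module.Basis (Fin N) k (AffFun k M)) (I : Fin N → A) :
    (gaussForm c I).IsHomogeneous N := by
  refine MvPolynomial.isHomogeneous_monomial _ ?_
  rw [map_sum]
  simp

theorem eval_gaussForm (c : Module.Basis (Fin N) k (AffFun k M)) (I : Fin N → A) (v : A → k) :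
    MvPolynomial.eval v (gaussForm c I) = gaussDet c I * ∏ b, v (I b) := by
  rw [gaussForm, MvPolynomial.eval_monomial, Finsupp.prod_fintype _ _ (by simp)]
  congr 1
  have := sum_sum_single_smul (N' := Additive k) I (fun u => Additive.ofMul (v u))
  have h2 := congrArg Additive.toMul this
  rw [toMul_sum, toMul_sum] at h2
  simpa using h2

theorem torusFieldHom_gaussForm (c : Module.Basis (Fin N) k (AffFun k M)) (I : Fin N → A) :
    torusFieldHom k A (gaussForm c I) =
      algebraMap k _ (gaussDet c I) * zMon k (∑ b, (I b : M), (N : ℤ)) := by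
  rw [torusFieldHom_apply, gaussForm, torusHom_monomial,
    sum_sum_single_smul I fun u : A => ((u : M), (1 : ℤ))]
  have h1 : ∑ b, ((I b : M), (1 : ℤ)) = (∑ b, (I b : M), (N : ℤ)) := by
    ext
    · simp [Prod.fst_sum]
    · simp [Prod.snd_sum]
  rw [h1, zMon, IsScalarTower.algebraMap_apply k (AddMonoidAlgebra k (M × ℤ)), ← map_mul]
  congr 1
  simp [AddMonoidAlgebra.single_mul_single]

theorem sum_eval_pderiv_gaussForm (c : Module.Basis (Fin N) k (AffFun k M)) (I : Fin N → A)
    (v : A → k) (a : AffFun k M) :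
    ∑ u, MvPolynomial.eval v (MvPolynomial.pderiv u (gaussForm c I)) * tangentParam v a u =
      MvPolynomial.eval v (gaussForm c I) * ∑ b, affEval (I b : M) a := by
  simp only [tangentParam_apply]
  rw [gaussForm, sum_eval_pderiv_monomial (y := fun u : A => affEval (u : M) a),
    sum_sum_single_smul I fun u : A => affEval (u : M) a]

/-- In the basis given by the tangent vectors of the c_a, the column of index I b has the common
factor v_{I b}; pulling these factors out of the minor leaves the monomial. -/
theorem AffinelyGenerates.isPluckerVector (hgen : AffinelyGenerates A)
    (c : Module.Basis (Fin N) k (AffFun k M)) {v : A → k} (hv : ∀ u, v u ≠ 0) :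
    IsPluckerVector (LinearMap.range (tangentParam (k := k) v))
      fun I : Fin N → A => MvPolynomial.eval v (gaussForm c I) := by
  refine ⟨fun a => tangentParam v (c a), ?_, ?_, funext fun I => ?_⟩
  · exact c.linearIndependent.map' _ (LinearMap.ker_eq_bot.2 (hgen.tangentParam_injective hv))
  · have : (Set.range fun a => tangentParam v (c a)) = tangentParam (k := k) v '' Set.range c := by
      rw [← Set.range_comp]
      rfl
    rw [this, ← Submodule.map_span, c.span_eq, Submodule.map_top]
  · rw [eval_gaussForm, gaussDet, mul_comm, ← Matrix.det_mul_row]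
    rfl

end GaussForm

/-! ### The Gauss map at general points -/

section GaussMap

variable {k : Type*} [Field k] {M : Type*} [AddCommGroup M] [Module.Free ℤ M] [Module.Finite ℤ M]
  {A : Finset M} [Infinite k]

theorem prod_X_notMem_ideal (hA : A.Nonempty) :
    ∏ u : A, MvPolynomial.X u ∉ (toricVariety (k := k) A hA).ideal := by
  intro h
  obtain ⟨u, -, hu⟩ := (Ideal.IsPrime.prod_mem_iff (s := Finset.univ)).1 h
  exact X_notMem_ideal hA u hu

/-- A property which holds at the points of the torus where a given form does not vanish holds
generically. -/
theorem AffinelyGenerates.generically (hgen : AffinelyGenerates A) (hA : A.Nonempty)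
    {P Q : ℙ k (A → k) → Prop} (hP : (toricVariety (k := k) A hA).Generically P)
    (h : ∀ x ∈ (toricVariety (k := k) A hA).carrier,
      ∀ χ : Torus k (M × ℤ), coneVec A χ = x.rep → P x → Q x) :
    (toricVariety (k := k) A hA).Generically Q := by
  obtain ⟨d, g, hg, hgX, hgP⟩ := hP
  -- Multiplying by all coordinates restricts to points without zero coordinates, which are torus
  -- points.
  refine ⟨_, g * ∏ u, MvPolynomial.X u, hg.mul isHomogeneous_prod_X, ?_, fun x hx hne => ?_⟩
  · intro h
    rcases Ideal.IsPrime.mem_or_mem inferInstance h with h1 | h1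
    · exact hgX h1
    · exact prod_X_notMem_ideal hA h1
  · rw [map_mul, map_prod] at hne
    simp only [MvPolynomial.eval_X] at hne
    obtain ⟨χ, hχ⟩ := hgen.exists_coneVec_eq_rep hA hx
      fun u => Finset.prod_ne_zero_iff.1 (right_ne_zero_of_mul hne) u (Finset.mem_univ u)
    exact h x hx χ hχ (hgP x hx (left_ne_zero_of_mul hne))

theorem generically_true (hA : A.Nonempty) :
    (toricVariety (k := k) A hA).Generically fun _ => True :=
  ⟨0, 1, MvPolynomial.isHomogeneous_one _ _,
    fun h => (inferInstance : (toricVariety (k := k) A hA).ideal.IsPrime).ne_top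
      ((Ideal.eq_top_iff_one _).2 h), fun _ _ _ => trivial⟩

theorem mem_ideal_of_generically (hA : A.Nonempty) {f : MvPolynomial A k} {d : ℕ}
    (hf : f.IsHomogeneous d)
    (h : (toricVariety (k := k) A hA).Generically fun x => MvPolynomial.eval x.rep f = 0) :
    f ∈ (toricVariety (k := k) A hA).ideal := by
  obtain ⟨e, g, hg, hgX, hgP⟩ := h
  have h1 : f * g ∈ (toricVariety (k := k) A hA).ideal := by
    refine mem_vanishingIdeal_of_eval_rep (hf.mul hg) fun x hx => ?_
    rw [map_mul]
    by_cases h0 : MvPolynomial.eval x.rep g = 0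
    · rw [h0, mul_zero]
    · rw [hgP x hx h0, zero_mul]
  exact (Ideal.IsPrime.mem_or_mem inferInstance h1).resolve_right hgX

variable {N : ℕ}

theorem AffinelyGenerates.exists_gaussForm_notMem (hgen : AffinelyGenerates A) (hA : A.Nonempty)
    (hN : N = Module.finrank ℤ M + 1) (c : Module.Basis (Fin N) k (AffFun k M)) :
    ∃ I : Fin N → A, gaussForm c I ∉ (toricVariety (k := k) A hA).ideal := by
  obtain ⟨I, hI⟩ := hgen.exists_isSpanningTuple (k := k) hN
  refine ⟨I, ?_⟩
  rw [← torusFieldHom_eq_zero_iff, torusFieldHom_gaussForm]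
  exact mul_ne_zero ((map_ne_zero _).2 ((gaussDet_ne_zero_iff c I).2 hI)) (zMon_ne_zero _)

variable (k) in
theorem AffinelyGenerates.exists_basis_affFun (hgen : AffinelyGenerates A) (hA : A.Nonempty) :
    Nonempty (Module.Basis (Fin ((toricVariety (k := k) A hA).dim + 1)) k (AffFun k M)) :=
  ⟨Module.finBasisOfFinrankEq k _ (by rw [finrank_affFun, hgen.dim_toricVariety hA])⟩

theorem AffinelyGenerates.exists_isGaussMap (hgen : AffinelyGenerates A) (hA : A.Nonempty) :
    ∃ γ, (toricVariety (k := k) A hA).IsGaussMap γ := by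
  obtain ⟨c⟩ := hgen.exists_basis_affFun k hA
  refine ⟨⟨gaussForm c, _, isHomogeneous_gaussForm c,
    hgen.exists_gaussForm_notMem hA (by rw [hgen.dim_toricVariety hA]) c⟩,
    hgen.generically hA (generically_true hA) fun x hx χ hχ _ =>
      ⟨hgen.isSmoothAt hA hx hχ, ?_⟩⟩
  rw [hgen.tangentSpace_eq_range hA hχ]
  exact hgen.isPluckerVector c fun u => hχ ▸ coneVec_ne_zero χ u

variable {hA : A.Nonempty}
  {γ : RationalMap (toricVariety (k := k) A hA) (Fin ((toricVariety (k := k) A hA).dim + 1) → A)}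

theorem AffinelyGenerates.gaussMap_generically (hgen : AffinelyGenerates A)
    (hγ : (toricVariety (k := k) A hA).IsGaussMap γ)
    (c : Module.Basis (Fin ((toricVariety (k := k) A hA).dim + 1)) k (AffFun k M)) :
    (toricVariety (k := k) A hA).Generically fun x => (∃ χ, coneVec A χ = x.rep) ∧
      (toricVariety (k := k) A hA).IsSmoothAt x ∧ ∃ h : k, h ≠ 0 ∧ ∀ I,
        MvPolynomial.eval x.rep (γ.poly I) = h * MvPolynomial.eval x.rep (gaussForm c I) := by
  refine hgen.generically hA hγ fun x hx χ hχ hP => ⟨⟨χ, hχ⟩, hP.1, ?_⟩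
  have h1 := hP.2
  rw [hgen.tangentSpace_eq_range hA hχ] at h1
  obtain ⟨h, hh, heq⟩ := h1.exists_eq_smul
    (hgen.isPluckerVector c fun u => hχ ▸ coneVec_ne_zero χ u)
  exact ⟨h, hh, fun I => congrFun heq I⟩

/-- A Gauss map of a toric variety is proportional to the one given by the Gauss forms. -/
theorem AffinelyGenerates.gaussMap_mul_sub_mem (hgen : AffinelyGenerates A)
    (hγ : (toricVariety (k := k) A hA).IsGaussMap γ)
    (c : Module.Basis (Fin ((toricVariety (k := k) A hA).dim + 1)) k (AffFun k M))
    (I J : Fin ((toricVariety (k := k) A hA).dim + 1) → A) :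
    γ.poly I * gaussForm c J - γ.poly J * gaussForm c I ∈ (toricVariety (k := k) A hA).ideal := by
  refine mem_ideal_of_generically hA (((γ.isHomogeneous I).mul (isHomogeneous_gaussForm c J)).sub
    ((γ.isHomogeneous J).mul (isHomogeneous_gaussForm c I))) ?_
  refine hgen.generically hA (hgen.gaussMap_generically hγ c) fun x _ _ _ hP => ?_
  obtain ⟨-, -, h, -, hh⟩ := hP
  rw [map_sub, map_mul, map_mul, hh, hh]
  ring

/-! ### The rank of the Gauss map -/

/-- Parametrise the tangent space by affine functions. Modulo the line through the image point, the
differential kills a exactly when a has the same sum over all spanning tuples; rank-nullity on the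
(n + 1)-dimensional space of affine functions then concludes. -/
theorem AffinelyGenerates.rankAt_add (hgen : AffinelyGenerates A)
    (hγ : (toricVariety (k := k) A hA).IsGaussMap γ)
    (c : Module.Basis (Fin ((toricVariety (k := k) A hA).dim + 1)) k (AffFun k M))
    {x : ℙ k (A → k)} {χ : Torus k (M × ℤ)} (hχ : coneVec A χ = x.rep) {h : k} (hh : h ≠ 0)
    (heq : ∀ I, MvPolynomial.eval x.rep (γ.poly I) =
      h * MvPolynomial.eval x.rep (gaussForm c I)) :
    γ.rankAt x + Module.finrank k (gaussAnnihilator k A) = Module.finrank ℤ M + 1 := by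
  have hN : (toricVariety (k := k) A hA).dim + 1 = Module.finrank ℤ M + 1 := by
    rw [hgen.dim_toricVariety hA]
  have hv : ∀ u, x.rep u ≠ 0 := fun u => hχ ▸ coneVec_ne_zero χ u
  have hT := hgen.tangentSpace_eq_range hA hχ
  set ψ : AffFun k M →ₗ[k] _ := ((Submodule.span k {γ.evalAt x}).mkQ ∘ₗ γ.coneDifferential x) ∘ₗ
    tangentParam x.rep with hψ
  have h1 : γ.rankAt x = Module.finrank k (LinearMap.range ψ) := by
    rw [RationalMap.rankAt, hT, hψ, LinearMap.range_comp (tangentParam x.rep)]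
  have hq : ∀ I, MvPolynomial.eval x.rep (gaussForm c I) ≠ 0 ↔
      IsSpanningTuple k fun b => (I b : M) := by
    intro I
    rw [eval_gaussForm, mul_ne_zero_iff, gaussDet_ne_zero_iff, and_iff_left]
    exact Finset.prod_ne_zero_iff.2 fun b _ => hv _
  obtain ⟨I₀, hI₀⟩ := hgen.exists_isSpanningTuple (k := k) hN
  have hq₀ := (hq I₀).2 hI₀
  have hD : ∀ a J, γ.coneDifferential x (tangentParam x.rep a) J =
      ∑ u, MvPolynomial.eval x.rep (MvPolynomial.pderiv u (γ.poly J)) *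
        tangentParam x.rep a u := by
    intro a J
    simp [RationalMap.coneDifferential]
  -- Obtained by differentiating, in the direction of a, the proportionality between γ and the
  -- monomial forms, which holds modulo the ideal. This makes the computation independent of the
  -- representative of γ.
  have hrel : ∀ a J, γ.coneDifferential x (tangentParam x.rep a) J *
      MvPolynomial.eval x.rep (gaussForm c I₀) = MvPolynomial.eval x.rep (gaussForm c J) *
        (γ.coneDifferential x (tangentParam x.rep a) I₀ +
          h * MvPolynomial.eval x.rep (gaussForm c I₀) *
            (∑ b, affEval (J b : M) a - ∑ b, affEval (I₀ b : M) a)) := by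
    intro a J
    have h2 : tangentParam x.rep a ∈ (toricVariety (k := k) A hA).tangentSpace x := by
      rw [hT]
      exact ⟨a, rfl⟩
    have h3 := h2 _ (hgen.gaussMap_mul_sub_mem hγ c I₀ J)
    simp only [map_sub, Derivation.leibniz, smul_eq_mul, map_add, map_mul, sub_mul, add_mul,
      Finset.sum_sub_distrib, Finset.sum_add_distrib, mul_assoc, ← Finset.mul_sum] at h3
    rw [sum_eval_pderiv_gaussForm, sum_eval_pderiv_gaussForm, ← hD, ← hD, heq, heq] at h3
    linear_combination -h3
  have hker : LinearMap.ker ψ = gaussAnnihilator k A := by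
    ext a
    rw [LinearMap.mem_ker, mem_gaussAnnihilator_iff hN, hψ, LinearMap.comp_apply,
      LinearMap.comp_apply, Submodule.mkQ_apply, Submodule.Quotient.mk_eq_zero,
      Submodule.mem_span_singleton]
    constructor
    · rintro ⟨e, he⟩
      have he' : ∀ J, e * (h * MvPolynomial.eval x.rep (gaussForm c J)) =
          γ.coneDifferential x (tangentParam x.rep a) J := by
        intro J
        rw [← heq, ← he]
        rfl
      have key : ∀ J : Fin ((toricVariety (k := k) A hA).dim + 1) → A,
          IsSpanningTuple k (fun b => (J b : M)) →
            ∑ b, affEval (J b : M) a = ∑ b, affEval (I₀ b : M) a := by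
        intro J hJ
        have h2 := hrel a J
        rw [← he', ← he'] at h2
        have h3 : MvPolynomial.eval x.rep (gaussForm c J) *
            (h * MvPolynomial.eval x.rep (gaussForm c I₀)) *
              (∑ b, affEval (J b : M) a - ∑ b, affEval (I₀ b : M) a) = 0 := by
          linear_combination -h2
        exact sub_eq_zero.1 ((mul_eq_zero.1 h3).resolve_left
          (mul_ne_zero ((hq J).2 hJ) (mul_ne_zero hh hq₀)))
      intro I J hI hJ
      rw [key I hI, key J hJ]
    · intro ha
      refine ⟨γ.coneDifferential x (tangentParam x.rep a) I₀ /
        (h * MvPolynomial.eval x.rep (gaussForm c I₀)), funext fun J => ?_⟩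
      rw [Pi.smul_apply, smul_eq_mul, RationalMap.evalAt, heq, div_mul_eq_mul_div,
        div_eq_iff (mul_ne_zero hh hq₀)]
      have h2 := hrel a J
      by_cases hJ : IsSpanningTuple k fun b => (J b : M)
      · rw [ha J I₀ hJ hI₀] at h2
        linear_combination -h * h2
      · have h3 := not_not.1 (mt (hq J).1 hJ)
        rw [h3] at h2 ⊢
        linear_combination -h * h2
  have h2 := LinearMap.finrank_range_add_finrank_ker ψ
  rw [hker, finrank_affFun] at h2
  rw [h1, h2]

theorem AffinelyGenerates.exists_hasRank (hgen : AffinelyGenerates A)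
    (hγ : (toricVariety (k := k) A hA).IsGaussMap γ) :
    ∃ r : ℕ, γ.HasRank r ∧
      r + Module.finrank k (gaussAnnihilator k A) = Module.finrank ℤ M + 1 := by
  obtain ⟨c⟩ := hgen.exists_basis_affFun k hA
  have hle : Module.finrank k (gaussAnnihilator k A) ≤ Module.finrank ℤ M + 1 := by
    rw [← finrank_affFun k M]
    exact Submodule.finrank_le _
  refine ⟨Module.finrank ℤ M + 1 - Module.finrank k (gaussAnnihilator k A), ?_, by omega⟩
  refine hgen.generically hA (hgen.gaussMap_generically hγ c) fun x _ χ hχ hP => ?_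
  obtain ⟨-, hsm, h, hh, heq⟩ := hP
  refine ⟨hsm, fun h0 => ?_, ?_⟩
  · obtain ⟨I, hI⟩ := hgen.exists_isSpanningTuple (k := k)
      (show (toricVariety (k := k) A hA).dim + 1 = _ by rw [hgen.dim_toricVariety hA])
    have h1 : h * MvPolynomial.eval x.rep (gaussForm c I) = 0 := by
      rw [← heq]
      exact congrFun h0 I
    rw [eval_gaussForm] at h1
    refine mul_ne_zero hh (mul_ne_zero ((gaussDet_ne_zero_iff c I).2 hI)
      (Finset.prod_ne_zero_iff.2 fun b _ => ?_)) h1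
    rw [← hχ]
    exact coneVec_ne_zero χ _
  · have := hgen.rankAt_add hγ c hχ hh heq
    omega

/-! ### The function field of the image of the Gauss map -/

/-- For spanning I and J, the quotient of the coordinates of γ is a nonzero constant times z^(b -
b') with b, b' in B, so all these monomials lie in the image field. Conversely, these quotients
generate a field inside that of the monomials of ⟨B - B⟩. -/
theorem AffinelyGenerates.exponents_imageField (hgen : AffinelyGenerates A)
    (hγ : (toricVariety (k := k) A hA).IsGaussMap γ) :
    exponents (γ.imageField.map (coneEmb hA)) = gaussLattice k A := by
  obtain ⟨c⟩ := hgen.exists_basis_affFun k hA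
  have hN : (toricVariety (k := k) A hA).dim + 1 = Module.finrank ℤ M + 1 := by
    rw [hgen.dim_toricVariety hA]
  set x := fun I => torusFieldHom k A (γ.poly I) with hx
  have hrel : ∀ I J, x I * torusFieldHom k A (gaussForm c J) =
      x J * torusFieldHom k A (gaussForm c I) := by
    intro I J
    rw [← sub_eq_zero, ← map_mul, ← map_mul, ← map_sub, torusFieldHom_eq_zero_iff hA]
    exact hgen.gaussMap_mul_sub_mem hγ c I J
  have hne : ∀ I, torusFieldHom k A (gaussForm c I) ≠ 0 ↔
      IsSpanningTuple k fun b => (I b : M) := by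
    intro I
    rw [torusFieldHom_gaussForm, mul_ne_zero_iff, and_iff_left (zMon_ne_zero _), map_ne_zero,
      gaussDet_ne_zero_iff]
  have hxne : ∀ I, IsSpanningTuple k (fun b => (I b : M)) → x I ≠ 0 := by
    intro I hI h0
    obtain ⟨J, hJ⟩ := γ.exists_notMem
    rw [← torusFieldHom_eq_zero_iff hA] at hJ
    have h1 := hrel I J
    rw [h0, zero_mul] at h1
    exact mul_ne_zero hJ ((hne I).2 hI) h1.symm
  have hfrac : ∀ I J, torusFieldHom k A (gaussForm c I) / torusFieldHom k A (gaussForm c J) =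
      algebraMap k _ (gaussDet c I / gaussDet c J) *
        zMon k (∑ b, (I b : M) - ∑ b, (J b : M), (0 : ℤ)) := by
    intro I J
    have h1 : (∑ b, (I b : M) - ∑ b, (J b : M), (0 : ℤ)) =
        (∑ b, (I b : M), (((toricVariety (k := k) A hA).dim + 1 : ℕ) : ℤ)) -
          (∑ b, (J b : M), (((toricVariety (k := k) A hA).dim + 1 : ℕ) : ℤ)) := by simp
    rw [h1, zMon_sub, torusFieldHom_gaussForm, torusFieldHom_gaussForm, mul_div_mul_comm, map_div₀]
  obtain ⟨I₀, hI₀⟩ := hgen.exists_isSpanningTuple (k := k) hN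
  refine le_antisymm ?_ ?_
  · have hle : γ.imageField.map (coneEmb hA) ≤ monomialField k (gaussLattice k A) := by
      rw [RationalMap.imageField, IntermediateField.adjoin_map, IntermediateField.adjoin_le_iff]
      rintro _ ⟨_, ⟨e, f, g, hf, hg, -, rfl⟩, rfl⟩
      have h1 : ∀ f : MvPolynomial (Fin ((toricVariety (k := k) A hA).dim + 1) → A) k,
          torusFieldHom k A (MvPolynomial.aeval γ.poly f) = MvPolynomial.aeval x f := by
        intro f
        rw [← AlgHom.comp_apply, MvPolynomial.comp_aeval]
      change coneEmb hA _ ∈ monomialField k (gaussLattice k A)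
      rw [coneEmb_frac, h1, h1]
      refine aeval_div_aeval_mem _ (h := x I₀)
        (y := fun I => torusFieldHom k A (gaussForm c I) / torusFieldHom k A (gaussForm c I₀))
        (fun I => ?_) (fun I => ?_) hf hg
      · rw [← mul_div_assoc, eq_div_iff ((hne I₀).2 hI₀)]
        exact hrel I I₀
      · by_cases hI : IsSpanningTuple k fun b => (I b : M)
        · rw [hfrac]
          refine mul_mem (IntermediateField.algebraMap_mem _ _)
            (IntermediateField.subset_adjoin _ _ ⟨_, ?_, rfl⟩)
          exact sum_sub_sum_mem_gaussLattice hN hI hI₀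
        · rw [not_not.1 (mt (hne I).1 hI), zero_div]
          exact zero_mem _
    intro m hm
    rw [← exponents_monomialField (k := k) (gaussLattice k A)]
    exact hle hm
  · rw [gaussLattice_le_iff hN]
    intro I J hI hJ
    rw [mem_exponents]
    have h1 : x I / x J ∈ γ.imageField.map (coneEmb hA) := by
      refine ⟨_, IntermediateField.subset_adjoin k _ ⟨1, MvPolynomial.X I, MvPolynomial.X J,
        MvPolynomial.isHomogeneous_X _ _, MvPolynomial.isHomogeneous_X _ _, ?_, rfl⟩, ?_⟩
      · rw [MvPolynomial.aeval_X, ← torusFieldHom_eq_zero_iff hA]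
        exact hxne J hJ
      · change coneEmb hA _ = _
        rw [MvPolynomial.aeval_X, MvPolynomial.aeval_X, coneEmb_frac]
    have h2 : x I / x J = algebraMap k _ (gaussDet c I / gaussDet c J) *
        zMon k (∑ b, (I b : M) - ∑ b, (J b : M), (0 : ℤ)) := by
      rw [← hfrac, div_eq_div_iff (hxne J hJ) ((hne J).2 hJ), hrel, mul_comm]
    have hd : gaussDet c I / gaussDet c J ≠ 0 :=
      div_ne_zero ((gaussDet_ne_zero_iff c I).2 hI) ((gaussDet_ne_zero_iff c J).2 hJ)
    have h3 : zMon k (∑ b, (I b : M) - ∑ b, (J b : M), (0 : ℤ)) =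
        algebraMap k _ (gaussDet c I / gaussDet c J)⁻¹ * (x I / x J) := by
      rw [h2, ← mul_assoc, ← map_mul, inv_mul_cancel₀ hd, map_one, one_mul]
    rw [h3]
    exact mul_mem (IntermediateField.algebraMap_mem _ _) h1

/-- If the Gauss map is separable, then `M / ⟨B - B⟩` has no torsion of order the
characteristic. -/
theorem AffinelyGenerates.mem_gaussLattice_of_isSeparable (hgen : AffinelyGenerates A)
    (hγ : (toricVariety (k := k) A hA).IsGaussMap γ) (hsep : γ.IsSeparable) {p : ℕ} (hp : p.Prime)
    (hp0 : (p : k) = 0) {m : M} (hm : p • m ∈ gaussLattice k A) : m ∈ gaussLattice k A := by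
  have h1 : m ∈ exponents ((toricVariety (k := k) A hA).functionField.map (coneEmb hA)) := by
    rw [hgen.exponents_functionField hA]
    trivial
  obtain ⟨z, hz, hzm⟩ := h1
  rw [← hgen.exponents_imageField hγ] at hm ⊢
  obtain ⟨y, hy, hym⟩ := hm
  -- Here z corresponds to z^m and y to z^(pm): the element z is a p-th root of an element of the
  -- image field.
  have hyz : y = z ^ p := by
    apply (coneEmb hA).injective
    rw [map_pow]
    refine Eq.trans hym ?_
    refine Eq.trans ?_ (congrArg (· ^ p) hzm.symm)
    rw [← zMon_nsmul]
    simp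
  have hp0' : (p : γ.imageField) = 0 := by
    rw [← map_natCast (algebraMap k γ.imageField), hp0, map_zero]
  have h2 := mem_range_algebraMap_of_pow_mem hsep hp hp0'
    (α := (⟨z, hz⟩ : IntermediateField.extendScalars γ.imageField_le))
    ⟨⟨y, hy⟩, Subtype.ext hyz⟩
  obtain ⟨w, hw⟩ := h2
  have hwz : (w : (toricVariety (k := k) A hA).ConeField) = z := congrArg Subtype.val hw
  exact ⟨z, hwz ▸ w.2, hzm⟩

end GaussMap

/-! ### Linear subspaces -/

theorem ite_eq_pi_single {k : Type*} [Field k] {ι : Type*} [DecidableEq ι] (i : ι) :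
    (fun l => if i = l then (1 : k) else 0) = Pi.single i 1 := by
  ext l
  simp [Pi.single_apply, eq_comm]

/-- A point off the range of j is excluded by a linear form vanishing on that range. In the other
direction, a polynomial vanishing on the image pulls back along j to one vanishing on S, hence
everywhere. -/
theorem zariskiClosure_map_image {k : Type*} [Field k] {ι κ : Type*} [Fintype ι] [Fintype κ]
    (j : (κ → k) →ₗ[k] (ι → k)) (hj : Function.Injective j) {S : Set (ℙ k (κ → k))}
    (hS : zariskiClosure S = Set.univ) :
    zariskiClosure (Projectivization.map j hj '' S) = Projectivization.map j hj '' Set.univ := by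
  classical
  refine Set.Subset.antisymm (fun x hx => ?_) ?_
  · induction x using Projectivization.ind with
    | h v hv =>
    obtain ⟨w, hw⟩ : v ∈ LinearMap.range j := by
      by_contra hcon
      obtain ⟨θ, hθ, hle⟩ := Submodule.exists_le_ker_of_notMem hcon
      apply hθ
      let f : MvPolynomial ι k := ∑ i, MvPolynomial.C (θ (Pi.single i 1)) * MvPolynomial.X i
      have hf : ∀ w, MvPolynomial.eval w f = θ w := by
        intro w
        rw [LinearMap.pi_apply_eq_sum_univ θ w]
        simp only [f, map_sum, map_mul, MvPolynomial.eval_C, MvPolynomial.eval_X, smul_eq_mul]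
        refine Finset.sum_congr rfl fun i _ => ?_
        rw [mul_comm, ite_eq_pi_single]
      rw [← hf]
      refine hx f ?_ v hv rfl
      rintro _ ⟨y, -, rfl⟩ w hw hwy
      induction y using Projectivization.ind with
      | h z hz =>
      rw [Projectivization.map_mk, Projectivization.mk_eq_mk_iff] at hwy
      obtain ⟨c, rfl⟩ := hwy
      rw [hf]
      exact hle (Submodule.smul_mem _ (c : k) ⟨z, rfl⟩)
    have hw0 : w ≠ 0 := by
      rintro rfl
      exact hv (by rw [← hw, map_zero])
    refine ⟨Projectivization.mk k w hw0, trivial, ?_⟩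
    rw [Projectivization.map_mk]
    congr
  · rintro _ ⟨y, -, rfl⟩ f hf v hv hvy
    have hy : y ∈ zariskiClosure S := by
      rw [hS]
      trivial
    let F : MvPolynomial κ k := MvPolynomial.aeval
      (fun i => ∑ l, MvPolynomial.C (j (Pi.single l 1) i) * MvPolynomial.X l) f
    have hF : ∀ w, MvPolynomial.eval w F = MvPolynomial.eval (j w) f := by
      intro w
      have h1 : (MvPolynomial.aeval w).comp (MvPolynomial.aeval
          (fun i => ∑ l, MvPolynomial.C (j (Pi.single l 1) i) * MvPolynomial.X l)) =
            MvPolynomial.aeval (R := k) (j w) := by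
        ext i
        rw [LinearMap.pi_apply_eq_sum_univ j w]
        simp only [AlgHom.comp_apply, MvPolynomial.aeval_X, map_sum, map_mul,
          MvPolynomial.algHom_C, Finset.sum_apply, Pi.smul_apply, smul_eq_mul]
        refine Finset.sum_congr rfl fun l _ => ?_
        rw [mul_comm, ite_eq_pi_single]
        rfl
      exact DFunLike.congr_fun h1 f
    have hFS : F ∈ vanishingIdeal S := by
      rintro _ hz w hw rfl
      rw [hF]
      refine hf _ ⟨_, hz, rfl⟩ (j w) (fun h0 => hw (hj (by rw [h0, map_zero]))) ?_
      rw [Projectivization.map_mk]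
    induction y using Projectivization.ind with
    | h z hz =>
    rw [Projectivization.map_mk, Projectivization.mk_eq_mk_iff] at hvy
    obtain ⟨c, rfl⟩ := hvy
    have h1 : c • j z = j (c • z) := (map_smul j (c : k) z).symm
    have hz' : c • z ≠ 0 := fun h0 => hv (by rw [h1, h0, map_zero])
    rw [h1, ← hF]
    refine hy F hFS (c • z) hz' ?_
    rw [Projectivization.mk_eq_mk_iff]
    exact ⟨c, rfl⟩

/-! ### Affinely independent exponents -/

section Independent

variable {k : Type*} [Field k] {M : Type*} [AddCommGroup M] [Module.Free ℤ M] [Module.Finite ℤ M]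
  {A : Finset M}

/-- If `A` is affinely independent, then every vector without zero coordinates lies in the
torus. -/
theorem AffinelyGenerates.exists_coneVec_eq_of_card (hgen : AffinelyGenerates A)
    (hcard : A.card = Module.finrank ℤ M + 1) {v : A → k} (hv : ∀ u, v u ≠ 0) :
    ∃ χ : Torus k (M × ℤ), coneVec A χ = v := by
  -- These are n + 1 generators of a free module of rank n + 1, so there are no relations for v to
  -- respect.
  have hli : LinearIndependent ℤ (fun u : A => ((u : M), (1 : ℤ))) :=
    linearIndependent_of_top_le_span_of_card_eq_finrank hgen.ge (by
      rw [Module.finrank_prod, Module.finrank_self, Fintype.card_coe, hcard])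
  obtain ⟨f, hf⟩ := hgen.exists_hom (fun u => Additive.ofMul (Units.mk0 (v u) (hv u)))
    (fun s s' h => by
      have h1 := Fintype.linearIndependent_iff.1 hli (fun u => (s u : ℤ) - s' u) (by
        simp only [sub_smul, natCast_zsmul, Finset.sum_sub_distrib, h, sub_self])
      refine Finset.sum_congr rfl fun u _ => ?_
      rw [Int.ofNat.inj (sub_eq_zero.1 (h1 u))])
  refine ⟨AddMonoidHom.toMultiplicativeLeft f.toAddMonoidHom, funext fun u => ?_⟩
  have := congrArg (fun x => ((Additive.toMul x : kˣ) : k)) (hf u)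
  simpa [coneVec] using this

theorem AffinelyGenerates.zariskiClosure_range_torusPoint [Infinite k] (hgen : AffinelyGenerates A)
    (hA : A.Nonempty) (hcard : A.card = Module.finrank ℤ M + 1) :
    zariskiClosure (Set.range (torusPoint (k := k) A hA)) = Set.univ := by
  refine Set.eq_univ_of_forall fun x f hf v hv hvx => ?_
  rw [mem_vanishingIdeal_range] at hf
  -- The factor ∏ X_u kills the vectors outside the torus, and f vanishes on the torus; k is
  -- infinite.
  have h1 : f * ∏ u, MvPolynomial.X u = 0 := by
    refine MvPolynomial.funext fun w => ?_
    rw [map_mul, map_prod, map_zero]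
    simp only [MvPolynomial.eval_X]
    by_cases hw : ∀ u, w u ≠ 0
    · obtain ⟨χ, rfl⟩ := hgen.exists_coneVec_eq_of_card hcard hw
      obtain ⟨t, c, htc⟩ := coneVec_eq (A := A) χ
      rw [htc, hf t c, zero_mul]
    · push Not at hw
      obtain ⟨u, hu⟩ := hw
      rw [Finset.prod_eq_zero (Finset.mem_univ u) hu, mul_zero]
  have h2 : f = 0 := (mul_eq_zero.1 h1).resolve_right
    (Finset.prod_ne_zero_iff.2 fun u _ => MvPolynomial.X_ne_zero u)
  rw [h2, map_zero]

end Independent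

/-! ### The fibers of the Gauss map -/

section Fiber

variable {k : Type*} [Field k] {M : Type*} [AddCommGroup M] [Module.Free ℤ M] [Module.Finite ℤ M]
  {A : Finset M}

/-- Scaling affine functions by v' / v rewrites a tangent vector at v' as one at v. -/
theorem AffinelyGenerates.range_tangentParam_le (hgen : AffinelyGenerates A) {v v' : A → k}
    (hv : ∀ u, v u ≠ 0)
    (h : ∀ u u' : A, (u : M) - u' ∈ gaussLattice k A → v' u / v u = v' u' / v u') :
    LinearMap.range (tangentParam (k := k) v') ≤ LinearMap.range (tangentParam v) := by
  obtain ⟨I, hI⟩ := hgen.exists_isSpanningTuple (k := k) rfl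
  rintro _ ⟨a, rfl⟩
  refine ⟨hI.scale rfl (fun b => v' (I b) / v (I b)) a, funext fun u => ?_⟩
  rw [tangentParam_apply, tangentParam_apply,
    hI.affEval_scale_of_mem (lam := fun u => v' u / v u) rfl h, ← mul_assoc,
    mul_div_cancel₀ _ (hv u)]

variable [Infinite k]

/-- Equal tangent spaces have proportional Plücker vectors, so the product of the ratios t' / t is
the same over every spanning tuple; the character t' / t is then trivial on ⟨B - B⟩. The converse is
`range_tangentParam_le` in both directions. -/
theorem AffinelyGenerates.tangentSpace_torusPoint_eq_iff (hgen : AffinelyGenerates A)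
    (hA : A.Nonempty) (t t' : Torus k M) :
    (toricVariety (k := k) A hA).tangentSpace (torusPoint A hA t') =
        (toricVariety A hA).tangentSpace (torusPoint A hA t) ↔
      ∀ u u' : A, (u : M) - u' ∈ gaussLattice k A →
        torusVec A t' u / torusVec A t u = torusVec A t' u' / torusVec A t u' := by
  obtain ⟨c, hc⟩ := ToricGauss.exists_coneVec_eq_rep t hA
  obtain ⟨c', hc'⟩ := ToricGauss.exists_coneVec_eq_rep t' hA
  rw [hgen.tangentSpace_eq_range hA hc, hgen.tangentSpace_eq_range hA hc', ← hc, ← hc']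
  have hv := coneVec_ne_zero (A := A) (coneChar t c)
  have hv' := coneVec_ne_zero (A := A) (coneChar t' c')
  have hratio : ∀ u, coneVec A (coneChar t' c') u / coneVec A (coneChar t c) u =
      (c' : k) / c * (torusVec A t' u / torusVec A t u) := by
    intro u
    rw [coneVec_coneChar, coneVec_coneChar, mul_div_mul_comm]
  constructor
  · intro h
    let b := Module.finBasisOfFinrankEq k (AffFun k M) (finrank_affFun k M)
    obtain ⟨e, -, he⟩ := (h ▸ hgen.isPluckerVector b hv' :
      IsPluckerVector (LinearMap.range (tangentParam (k := k) (coneVec A (coneChar t c)))) _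
      ).exists_eq_smul (hgen.isPluckerVector b hv)
    have hprod : ∀ I : Fin (Module.finrank ℤ M + 1) → A,
        IsSpanningTuple k (fun b => (I b : M)) → ∏ b, (torusVec A t' (I b) / torusVec A t (I b)) =
          e / ((c' : k) / c) ^ (Module.finrank ℤ M + 1) := by
      intro I hI
      have h1 := congrFun he I
      rw [Pi.smul_apply, smul_eq_mul, eval_gaussForm, eval_gaussForm, mul_left_comm] at h1
      have h2 := mul_left_cancel₀ ((gaussDet_ne_zero_iff b I).2 hI) h1
      rw [← div_eq_iff (Finset.prod_ne_zero_iff.2 fun b _ => hv _), ← Finset.prod_div_distrib] at h2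
      simp only [hratio, Finset.prod_mul_distrib, Finset.prod_const, Finset.card_univ,
        Fintype.card_fin] at h2
      rw [eq_div_iff (pow_ne_zero _ (div_ne_zero c'.ne_zero c.ne_zero)), mul_comm]
      exact h2
    let θ : M →+ Additive kˣ := AddMonoidHom.toMultiplicativeLeft.symm (t' / t)
    have hθ : ∀ m, ((Additive.toMul (θ m) : kˣ) : k) =
        (t' (Multiplicative.ofAdd m) : k) / t (Multiplicative.ofAdd m) := by
      intro m
      simp [θ]
    have hle : gaussLattice k A ≤ AddSubgroup.toIntSubmodule θ.ker := by
      rw [gaussLattice_le_iff rfl]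
      intro I J hI hJ
      change θ _ = 0
      rw [map_sub, sub_eq_zero, map_sum, map_sum]
      apply Additive.toMul.injective
      apply Units.ext
      rw [toMul_sum, toMul_sum, Units.coe_prod, Units.coe_prod]
      simp only [hθ]
      exact (hprod I hI).trans (hprod J hJ).symm
    intro u u' huu
    have h1 : θ ((u : M) - u') = 0 := hle huu
    rw [map_sub, sub_eq_zero] at h1
    have h2 := congrArg (fun x => ((Additive.toMul x : kˣ) : k)) h1
    simp only [hθ] at h2
    exact h2
  · intro h
    refine le_antisymm (hgen.range_tangentParam_le hv fun u u' huu => ?_)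
      (hgen.range_tangentParam_le hv' fun u u' huu => ?_)
    · rw [hratio, hratio, h u u' huu]
    · rw [← inv_div, hratio, h u u' huu, ← hratio, inv_div]

/-- The class in `π(A)` of a point of `A`. -/
def gaussClass (k : Type*) [Field k] (A : Finset M) (u : A) : gaussImage k A :=
  ⟨(gaussKernel k A).mkQ u, by
    classical
    rw [gaussImage_eq_image]
    exact Finset.mem_image_of_mem _ u.2⟩

omit [Module.Free ℤ M] [Module.Finite ℤ M] [Infinite k] in
theorem gaussClass_surjective : Function.Surjective (gaussClass k A) := by
  classical
  rintro ⟨x, hx⟩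
  have hx' := hx
  rw [gaussImage_eq_image, Finset.mem_image] at hx'
  obtain ⟨u, hu, rfl⟩ := hx'
  exact ⟨⟨u, hu⟩, rfl⟩

omit [Module.Free ℤ M] [Module.Finite ℤ M] [Infinite k] in
theorem gaussClass_eq_iff {u u' : A} :
    gaussClass k A u = gaussClass k A u' ↔ (u : M) - u' ∈ gaussKernel k A := by
  rw [← Submodule.Quotient.eq]
  exact Subtype.ext_iff

/-- The linear map `(e_x) ↦ (z^u(t) e_{π(u)})`. -/
def fiberMap (A : Finset M) (t : Torus k M) : (gaussImage k A → k) →ₗ[k] (A → k) :=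
  LinearMap.pi fun u => torusVec A t u • LinearMap.proj (gaussClass k A u)

omit [Module.Free ℤ M] [Module.Finite ℤ M] [Infinite k] in
theorem fiberMap_apply (t : Torus k M) (e : gaussImage k A → k) (u : A) :
    fiberMap A t e u = torusVec A t u * e (gaussClass k A u) := rfl

omit [Module.Free ℤ M] [Module.Finite ℤ M] [Infinite k] in
theorem fiberMap_injective (t : Torus k M) : Function.Injective (fiberMap A t) := by
  rw [injective_iff_map_eq_zero]
  intro e he
  funext x
  obtain ⟨u, rfl⟩ := gaussClass_surjective x
  have h1 := congrFun he u
  rw [fiberMap_apply] at h1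
  exact (mul_eq_zero.1 h1).resolve_left (Units.ne_zero _)

/-- On the fiber, the ratio t' / t descends to a nowhere zero function on π(A). As π(A) is affinely
independent, every such function is, up to a scalar, a point s of the torus of M'. Conversely, such
an s gives the point t' = t · (s ∘ π) of the fiber. -/
theorem AffinelyGenerates.torusGaussFiber_eq (hgen : AffinelyGenerates A) (hA : A.Nonempty)
    (hcard : (gaussImage k A).card = Module.finrank ℤ (GaussQuotient k A) + 1)
    (hcls : ∀ u ∈ A, ∀ u' ∈ A, u - u' ∈ gaussKernel k A → u - u' ∈ gaussLattice k A)
    (t : Torus k M) :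
    torusGaussFiber A hA t = Projectivization.map (fiberMap A t) (fiberMap_injective t) ''
      Set.range (torusPoint (gaussImage k A) (gaussImage_nonempty hA)) := by
  classical
  have hgen' : AffinelyGenerates (gaussImage k A) := by
    rw [gaussImage_eq_image]
    exact hgen.image (gaussKernel k A).mkQ (Submodule.mkQ_surjective _)
  refine Set.Subset.antisymm ?_ ?_
  · rintro _ ⟨⟨t', rfl⟩, -, hT⟩
    rw [hgen.tangentSpace_torusPoint_eq_iff hA] at hT
    -- A choice of representative in A for each class; `hcls` makes the ratio independent of it.
    obtain ⟨σ, hσ⟩ := gaussClass_surjective (k := k) (A := A).hasRightInverse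
    obtain ⟨χ, hχ⟩ := hgen'.exists_coneVec_eq_of_card hcard
      (v := fun x => torusVec A t' (σ x) / torusVec A t (σ x))
      fun x => div_ne_zero (Units.ne_zero _) (Units.ne_zero _)
    obtain ⟨s, c, hs⟩ := coneVec_eq (A := gaussImage k A) χ
    refine ⟨_, ⟨s, rfl⟩, ?_⟩
    rw [torusPoint, torusPoint, Projectivization.map_mk, Projectivization.mk_eq_mk_iff]
    refine ⟨c⁻¹, funext fun u => ?_⟩
    have h1 := hT (σ (gaussClass k A u)) u
      (hcls _ (Subtype.prop _) _ u.2 (gaussClass_eq_iff.1 (hσ _)))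
    have h2 := congrFun (hs.symm.trans hχ) (gaussClass k A u)
    rw [h1] at h2
    have h3 : torusVec A t u ≠ 0 := Units.ne_zero _
    have h4 : (c : k) ≠ 0 := c.ne_zero
    change ((c⁻¹ : kˣ) : k) * torusVec A t' u = fiberMap A t _ u
    rw [fiberMap_apply, Units.val_inv_eq_inv_val, inv_mul_eq_iff_eq_mul₀ h4, mul_left_comm, h2,
      mul_div_cancel₀ _ h3]
  · rintro _ ⟨_, ⟨s, rfl⟩, rfl⟩
    let t' : Torus k M :=
      t * s.comp (AddMonoidHom.toMultiplicative (gaussKernel k A).mkQ.toAddMonoidHom)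
    have ht' : ∀ u : A, torusVec A t' u =
        torusVec A t u * torusVec (gaussImage k A) s (gaussClass k A u) := fun u => rfl
    have h1 : Projectivization.map (fiberMap A t) (fiberMap_injective t)
        (torusPoint (gaussImage k A) (gaussImage_nonempty hA) s) = torusPoint A hA t' := by
      rw [torusPoint, torusPoint, Projectivization.map_mk]
      congr
    rw [h1]
    refine ⟨⟨t', rfl⟩, ?_, ?_⟩
    · obtain ⟨c, hc⟩ := ToricGauss.exists_coneVec_eq_rep t' hA
      exact hgen.isSmoothAt hA (torusPoint_mem_carrier hA t') hc
    · rw [hgen.tangentSpace_torusPoint_eq_iff hA]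
      intro u u' huu
      have h2 : gaussClass k A u = gaussClass k A u' :=
        gaussClass_eq_iff.2 (le_realSaturation _ huu)
      rw [ht', ht', h2, mul_div_cancel_left₀ _ (show torusVec A t u ≠ 0 from Units.ne_zero _),
        mul_div_cancel_left₀ _ (show torusVec A t u' ≠ 0 from Units.ne_zero _)]

end Fiber

end ToricGauss

end

/-! ### The theorem -/

theorem corollary4p5 {k : Type*} [Field k] [IsAlgClosed k] {M : Type*} [AddCommGroup M]
    [Module.Free ℤ M] [Module.Finite ℤ M] (A : Finset M) (hA : A.Nonempty)
    (hspan : affineSpan ℤ (A : Set M) = ⊤) :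
    (∃ γ, (ToricGauss.toricVariety (k := k) A hA).IsGaussMap γ) ∧
    ∀ γ, (ToricGauss.toricVariety (k := k) A hA).IsGaussMap γ →
      (∃ r : ℕ, γ.HasRank r ∧
        (r : ℤ) ≤ (Module.finrank ℤ M : ℤ) - (((ToricGauss.gaussImage k A).card : ℤ) - 1)) ∧
      (γ.IsSeparable →
        (ToricGauss.gaussImage k A).card =
          Module.finrank ℤ (ToricGauss.GaussQuotient k A) + 1 ∧
        (ToricGauss.toricVariety (k := k) (ToricGauss.gaussImage k A)
          (ToricGauss.gaussImage_nonempty hA)).carrier = Set.univ ∧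
        ∀ t : ToricGauss.Torus k M,
          ∃ (j : (ToricGauss.gaussImage k A → k) →ₗ[k] (A → k)) (hj : Function.Injective j),
            ToricGauss.zariskiClosure (ToricGauss.torusGaussFiber A hA t) =
              Projectivization.map j hj ''
                (ToricGauss.toricVariety (k := k) (ToricGauss.gaussImage k A)
                  (ToricGauss.gaussImage_nonempty hA)).carrier) := by
  classical
  have hgen := ToricGauss.AffinelyGenerates.of_affineSpan_eq_top hspan
  refine ⟨hgen.exists_isGaussMap hA, fun γ hγ => ⟨?_, fun hsep => ?_⟩⟩
  · obtain ⟨r, hr, hsum⟩ := hgen.exists_hasRank hγ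
    have h1 := ToricGauss.card_gaussImage_le (k := k) A
    have h2 := hgen.card_image_le_finrank_gaussAnnihilator (k := k)
    -- Here r + dim Ann = n + 1 and #π(A) ≤ #(A mod ⟨B - B⟩) ≤ dim Ann.
    exact ⟨r, hr, by omega⟩
  · obtain ⟨hcard, hcls⟩ := hgen.card_gaussImage (k := k)
      fun p hp hp0 m hm => hgen.mem_gaussLattice_of_isSeparable hγ hsep hp hp0 hm
    have hgen' : ToricGauss.AffinelyGenerates (ToricGauss.gaussImage k A) := by
      rw [ToricGauss.gaussImage_eq_image]
      exact hgen.image (ToricGauss.gaussKernel k A).mkQ (Submodule.mkQ_surjective _)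
    have huniv := hgen'.zariskiClosure_range_torusPoint (k := k)
      (ToricGauss.gaussImage_nonempty hA) hcard
    have hcarrier : (ToricGauss.toricVariety (k := k) (ToricGauss.gaussImage k A)
        (ToricGauss.gaussImage_nonempty hA)).carrier = Set.univ := huniv
    refine ⟨hcard, hcarrier, fun t => ⟨ToricGauss.fiberMap A t,
      ToricGauss.fiberMap_injective t, ?_⟩⟩
    rw [hcarrier, hgen.torusGaussFiber_eq hA hcard hcls t]
    exact ToricGauss.zariskiClosure_map_image _ _ huniv
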